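/- Let $H$ be a finite directed graph with arc capacities $c\ge 0$ (every arc has a reverse arc, possibly of capacity $0$), with a source $s$ and a sink $t\neq s$, and let $A$ be a set of $k\ge 1$ vertices of $H$; in a $k$-apex graph, $A$ is a set of apices, i.e. $H-A$ is planar (planarity is not needed below). Put $X=A\cup\{s,t\}$. **Notation.** For a preflow $\rho$ the residual capacity of an arc is $c_\rho(u,v)=c(u,v)-\rho(u,v)+\rho(v,u)$, the excess $\mathrm{ex}(\rho,v)$ is inflow minus outflow, and a vertex $v\ne s,t$ is active if $\mathrm{ex}(\rho,v)>0$. Let $K$ be the complete graph on $X$. For $u\neq v$ in $X$, the arc $(u,v)$ of $K$ is residual if there is a path from $u$ to $v$ of arcs of positive residual capacity in $H$ with no internal vertex in $X$; otherwise it is saturated. For disjoint $U,W\subseteq X$, Bulk-Push$(U,W)$ replaces $\rho$ by $\rho+\eta$ (opposite flows are cancelled), where $\eta$ is a flow of maximum value with sources $U$ and sinks $W$ in the graph obtained from the residual graph of $\rho$ by deleting $X\setminus(U\cup W)$, subject to the restrictions that at most $\mathrm{ex}(\rho,u)$ leaves each $u\in U$ and that no flow enters a vertex of $U$ or leaves a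 vertex of $W$. **Algorithm** (batch-highest-distance push-relabel on $K$). It maintains a preflow $\rho$ in $H$ and labels $h:X\to\mathbb N$. Initially $h(s)=|X|$, $h=0$ on $X\setminus\{s\}$, and $\rho$ is the result of a Bulk-Push$(\{s\},X\setminus\{s\})$ on the zero flow in which $s$ may send an unlimited amount (i.e. the arcs of $K$ leaving $s$ are saturated). While there is an active vertex, let $h_{\max}$ be the largest label of an active vertex, $U$ the set of active vertices with label $h_{\max}$ and $W=\{w\in X: h(w)=h_{\max}-1\}$; execute Bulk-Push$(U,W)$, and then, in arbitrary order, Relabel each vertex $u\in U$ that is still active, i.e. set $h(u)=1+\min\{h(v): (u,v)\text{ residual arc of }K\}$. **Cost.** Reading or writing a label or reading an excess of a vertex of $X$ takes one time unit. A Bulk-Push takes $|X|$ time units (to delete the vertices of $X\setminus (U\cup W)$) plus the time of the maximum flow computation, which may be arbitrary. Relabel$(u)$ tests all arcs of $K$ leaving $u$. Let $T_{BP}$ be an upper bound on the time of each Bulk-Push of the execution and $q$ an upper bound on the time of each test whether an arc of $K$ is residual, and suppose that $kq\le a\,T_{BP}$. (If such a test takes one time unit, so that Relabel takes $O(k)$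 time, this holds with $a=1$, because $T_{BP}\ge |X|\ge k$.) **Claim.** For every $a\in\mathbb N$ there is a constant $C$, depending only on $a$, such that for all $H,c,s,t,A,k$ as above and for all choices of the maximum flows $\eta$ and of the orders of relabeling the following holds. 1. The algorithm can always be continued until it terminates. It terminates after at most $Ck^2$ iterations, with at most $Ck^2$ calls of Bulk-Push and at most $Ck^2$ calls of Relabel. The total running time is at most $C\,k^2\,T_{BP}$. 2. When it terminates, $\rho$ is a maximum flow from $s$ to $t$ in $H$. 3. After every Bulk-Push and every Relabel: (1) residual capacities and the excesses of all vertices other than $s$ are non-negative, so that $\rho$ is a feasible preflow, and vertices outside $X$ have excess $0$; (2) $h$ is a valid labeling, i.e. $h(s)=|X|$, $h(t)=0$, and $h(u)\le h(v)+1$ for every residual arc $(u,v)$ of $K$; (4) $h(v)\le 2|X|-1$ for all $v\in X$. Moreover (3) labels never decrease, and Relabel$(u)$, which is only called when $u$ is active and $h(u)\le h(v)$ for all residual arcs $(u,v)$ of $K$, strictly increases $h(u)$; and (5*) immediately after Bulk-Push$(U,W)$, for all $u\in U$ and $w\in W$ the arc $(u,w)$ of $K$ is saturated or $u$ is inactive.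 -/

import Mathlib

/-- A flow network with arc capacities on a vertex set `V`, with source `src` and sink `snk`.
Every ordered pair is an arc; pairs that are not arcs of the graph have capacity `0`. In particular
the reverse of every arc is present. -/
structure Network (V : Type) where
  cap : V → V → ℝ
  cap_nonneg : ∀ u v, 0 ≤ cap u v
  src : V
  snk : V
  src_ne_snk : src ≠ snk

/-- Excess (inflow minus outflow) of the vertex `v`. -/
noncomputable def excess {V : Type} [Fintype V] (ρ : V → V → ℝ) (v : V) : ℝ :=
  (∑ u, ρ u v) - ∑ u, ρ v u

/-- The sum of two (pre)flows: opposite flows on an arc and its reverse are cancelled. -/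
noncomputable def addFlow {V : Type} (ρ η : V → V → ℝ) : V → V → ℝ :=
  fun u v => max 0 (ρ u v + η u v - ρ v u - η v u)

namespace Network

/-- Residual capacity of the arc `(u, v)` with respect to `ρ`. -/
def resCap {V : Type} (N : Network V) (ρ : V → V → ℝ) (u v : V) : ℝ :=
  N.cap u v - ρ u v + ρ v u

/-- Feasible preflows. -/
structure IsPreflow {V : Type} [Fintype V] (N : Network V) (ρ : V → V → ℝ) : Prop where
  nonneg : ∀ u v, 0 ≤ ρ u v
  le_cap : ∀ u v, ρ u v ≤ N.cap u v
  excess_nonneg : ∀ v, v ≠ N.src → 0 ≤ excess ρ v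

/-- Feasible flows from the source to the sink. -/
structure IsFlow {V : Type} [Fintype V] (N : Network V) (ρ : V → V → ℝ) : Prop
    extends N.IsPreflow ρ where
  excess_eq_zero : ∀ v, v ≠ N.src → v ≠ N.snk → excess ρ v = 0

/-- Value of a (pre)flow: net amount leaving the source. -/
noncomputable def value {V : Type} [Fintype V] (N : Network V) (ρ : V → V → ℝ) : ℝ :=
  (∑ v, ρ N.src v) - ∑ v, ρ v N.src

/-- Maximum flows from the source to the sink. -/
def IsMaxFlow {V : Type} [Fintype V] (N : Network V) (ρ : V → V → ℝ) : Prop :=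
  N.IsFlow ρ ∧ ∀ ρ', N.IsFlow ρ' → N.value ρ' ≤ N.value ρ

/-- The vertex set `V^×`: the given apices together with the source and the sink. -/
def apices {V : Type} [DecidableEq V] (N : Network V) (A : Finset V) : Finset V :=
  insert N.src (insert N.snk A)

/-- The arc `(u, v)` of the complete graph `K^×` on `X` is residual: there is a residual path
from `u` to `v` in the network all of whose internal vertices lie outside `X`. -/
def ArcResidual {V : Type} (N : Network V) (X : Finset V) (ρ : V → V → ℝ) (u v : V) : Prop :=
  u ≠ v ∧ ∃ l : List V, (∀ x ∈ l, x ∉ X) ∧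
    List.IsChain (fun x y => 0 < N.resCap ρ x y) (u :: (l ++ [v]))

/-- A vertex other than source and sink is active if its excess is positive. -/
def IsActive {V : Type} [Fintype V] (N : Network V) (ρ : V → V → ℝ) (v : V) : Prop :=
  v ≠ N.src ∧ v ≠ N.snk ∧ 0 < excess ρ v

/-- `η` is a flow with sources `U` and sinks `W` in the graph `H_A`, `A = U ∪ W`, obtained from the
residual graph of `ρ` by deleting the vertices of `X \ A`, and the amount of flow leaving each
`u ∈ U` is at most `lim u`. Flow only leaves sources and only enters sinks, so that it consists of
paths from `U` to `W` with no internal vertex in `X` (which realise the arcs of `K^×` from `U` to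
`W`) and of cycles outside `X`. -/
structure IsBoundedFlow {V : Type} [Fintype V] [DecidableEq V] (N : Network V) (X : Finset V)
    (ρ : V → V → ℝ) (U W : Finset V) (lim : V → WithTop ℝ) (η : V → V → ℝ) : Prop where
  nonneg : ∀ u v, 0 ≤ η u v
  le_resCap : ∀ u v, η u v ≤ N.resCap ρ u v
  deleted : ∀ u v, u ∈ X \ (U ∪ W) ∨ v ∈ X \ (U ∪ W) → η u v = 0
  conserved : ∀ v, v ∉ U ∪ W → excess η v = 0
  source_no_in : ∀ u ∈ U, ∀ v, η v u = 0
  sink_no_out : ∀ w ∈ W, ∀ v, η w v = 0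
  bounded : ∀ u ∈ U, ((∑ v, η u v : ℝ) : WithTop ℝ) ≤ lim u

/-- A flow as above of maximum value. -/
def IsMaxBoundedFlow {V : Type} [Fintype V] [DecidableEq V] (N : Network V) (X : Finset V)
    (ρ : V → V → ℝ) (U W : Finset V) (lim : V → WithTop ℝ) (η : V → V → ℝ) : Prop :=
  N.IsBoundedFlow X ρ U W lim η ∧
    ∀ η', N.IsBoundedFlow X ρ U W lim η' → ∑ u ∈ U, ∑ v, η' u v ≤ ∑ u ∈ U, ∑ v, η u v

end Network

/-- What the algorithm maintains: a preflow in the network and labels of the vertices of `K^×`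
(labels of other vertices are never used). -/
structure PRState (V : Type) where
  flow : V → V → ℝ
  label : V → ℕ

/-- The steps of an execution. -/
inductive Event (V : Type) : Type
  /-- reading an excess or a label of a vertex of `K^×`, or writing an initial label -/
  | access : Event V
  /-- testing whether an arc of `K^×` is residual, with its running time -/
  | arcTest (time : ℕ) : Event V
  /-- a call of Bulk-Push `(U, W)`, with the states before and after it and its running time -/
  | bulkPush (U W : Finset V) (before after : PRState V) (time : ℕ) : Event V
  /-- the assignment of the new label that ends a call of Relabel `u`, with the states before and
  after it -/
  | relabel (u : V) (before after : PRState V) : Event V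

namespace Event

/-- Number of time units used by a step. -/
def time {V : Type} : Event V → ℕ
  | access => 1
  | arcTest c => c
  | bulkPush _ _ _ _ c => c
  | relabel _ _ _ => 1

def isBulkPush {V : Type} : Event V → Bool
  | bulkPush _ _ _ _ _ => true
  | _ => false

def isRelabel {V : Type} : Event V → Bool
  | relabel _ _ _ => true
  | _ => false

def isArcTest {V : Type} : Event V → Bool
  | arcTest _ => true
  | _ => false

end Event

/-- Nondeterministic programs that act on the state: `p σ a σ' tr` says that, started in `σ`, the
program `p` can return `a` and end in `σ'` after performing the steps `tr`. -/
def Prog (V : Type) (α : Type) : Type :=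
  PRState V → α → PRState V → List (Event V) → Prop

instance (V : Type) : Monad (Prog V) where
  pure a := fun σ b σ' tr => b = a ∧ σ' = σ ∧ tr = []
  bind p f := fun σ b σ'' tr =>
    ∃ a σ' tr₁ tr₂, p σ a σ' tr₁ ∧ f a σ' b σ'' tr₂ ∧ tr = tr₁ ++ tr₂

namespace Prog

/-- An arbitrary enumeration of a finite set. -/
def enum {V : Type} [DecidableEq V] (S : Finset V) : Prog V (List V) :=
  fun σ l σ' tr => l.Nodup ∧ l.toFinset = S ∧ σ' = σ ∧ tr = []

def readExcess {V : Type} [Fintype V] (v : V) : Prog V ℝ :=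
  fun σ x σ' tr => x = excess σ.flow v ∧ σ' = σ ∧ tr = [Event.access]

def readLabel {V : Type} (v : V) : Prog V ℕ :=
  fun σ n σ' tr => n = σ.label v ∧ σ' = σ ∧ tr = [Event.access]

def writeLabel {V : Type} [DecidableEq V] (v : V) (n : ℕ) : Prog V Unit :=
  fun σ _ σ' tr => σ' = ⟨σ.flow, Function.update σ.label v n⟩ ∧ tr = [Event.access]

def assignLabel {V : Type} [DecidableEq V] (u : V) (n : ℕ) : Prog V Unit :=
  fun σ _ σ' tr =>
    σ' = ⟨σ.flow, Function.update σ.label u n⟩ ∧ tr = [Event.relabel u σ σ']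

/-- Test whether the arc `(u, v)` of `K^×` is residual. -/
def testArc {V : Type} (N : Network V) (X : Finset V) (u v : V) : Prog V Bool :=
  fun σ b σ' tr =>
    (b = true ↔ N.ArcResidual X σ.flow u v) ∧ σ' = σ ∧ ∃ c, tr = [Event.arcTest c]

/-- Bulk-Push `(U, W)`, where each `u ∈ U` may send at most `lim σ u` in the state `σ`: construct
the graph `H_A` by going through the apices, which takes `X.card` time units, compute an
arbitrary maximum bounded flow in it, in an arbitrary number `c` of time units, and add it to the
preflow. -/
def bulkPush {V : Type} [Fintype V] [DecidableEq V] (N : Network V) (X : Finset V)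
    (U W : Finset V) (lim : PRState V → V → WithTop ℝ) : Prog V Unit :=
  fun σ _ σ' tr => ∃ η c, N.IsMaxBoundedFlow X σ.flow U W (lim σ) η ∧
    σ' = ⟨addFlow σ.flow η, σ.label⟩ ∧ tr = [Event.bulkPush U W σ σ' (X.card + c)]

open Classical in
/-- Test whether `v` is active. -/
noncomputable def testActive {V : Type} [Fintype V] (N : Network V) (v : V) : Prog V Bool := do
  let x ← readExcess v
  pure (decide (v ≠ N.src ∧ v ≠ N.snk ∧ 0 < x))

/-- Largest label of an active vertex (`none` if there is no active vertex). -/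
noncomputable def maxActiveLabel {V : Type} [Fintype V] [DecidableEq V] (N : Network V)
    (X : Finset V) : Prog V (Option ℕ) := do
  let l ← enum X
  l.foldlM (fun m v => do
    let b ← testActive N v
    let n ← readLabel v
    pure (if b then some (max n (m.getD 0)) else m)) none

/-- The set of active vertices with label `m`. -/
noncomputable def activeWithLabel {V : Type} [Fintype V] [DecidableEq V] (N : Network V)
    (X : Finset V) (m : ℕ) : Prog V (Finset V) := do
  let l ← enum X
  l.foldlM (fun S v => do
    let b ← testActive N v
    let n ← readLabel v
    pure (if b ∧ n = m then insert v S else S)) ∅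

/-- The set of vertices of `K^×` with label `m - 1`. -/
def oneBelow {V : Type} [DecidableEq V] (X : Finset V) (m : ℕ) : Prog V (Finset V) := do
  let l ← enum X
  l.foldlM (fun S v => do
    let n ← readLabel v
    pure (if n + 1 = m then insert v S else S)) ∅

/-- Relabel `u`: the new label is `1 + min {h v : (u, v) residual arc of K^×}`. -/
def relabel {V : Type} [DecidableEq V] (N : Network V) (X : Finset V) (u : V) :
    Prog V Unit := do
  let l ← enum (X.erase u)
  let m ← l.foldlM (fun (m : Option ℕ) v => do
    let b ← testArc N X u v
    let n ← readLabel v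
    pure (if b then some (min n (m.getD n)) else m)) none
  match m with
  | none => pure ()
  | some n => assignLabel u (n + 1)

/-- Initialization: the source gets the label `|V^×|` and all other vertices of `K^×` the label
`0`, and all arcs of `K^×` that leave the source are saturated, by a Bulk-Push from the source to
all other vertices of `K^×` in which the source may send an unlimited amount. -/
def setup {V : Type} [Fintype V] [DecidableEq V] (N : Network V) (X : Finset V) :
    Prog V Unit := do
  let l ← enum X
  l.forM (fun v => writeLabel v (if v = N.src then X.card else 0))
  bulkPush N X {N.src} (X.erase N.src) (fun _ _ => ⊤)

/-- One iteration of the main loop: stop (`false`) if there is no active vertex, and execute one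
pulse otherwise (`true`). -/
noncomputable def iteration {V : Type} [Fintype V] [DecidableEq V] (N : Network V)
    (X : Finset V) : Prog V Bool := do
  match ← maxActiveLabel N X with
  | none => pure false
  | some m =>
    let U ← activeWithLabel N X m
    let W ← oneBelow X m
    bulkPush N X U W (fun σ u => (excess σ.flow u : WithTop ℝ))
    let l ← enum U
    l.forM (fun u => do
      let b ← testActive N u
      if b then relabel N X u else pure ())
    pure true

end Prog

/-- Partial executions of the batch-highest-distance algorithm on `K^×`, the complete graph on `X`:
`Execution N X n b σ tr` says that the initialization followed by `n` iterations of the main loop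
can lead to the state `σ` by performing the steps `tr`; the algorithm is still running if `b` is
`true` and has terminated if `b` is `false`. -/
inductive Execution {V : Type} [Fintype V] [DecidableEq V] (N : Network V) (X : Finset V) :
    ℕ → Bool → PRState V → List (Event V) → Prop
  | start {σ : PRState V} {tr : List (Event V)} :
      Prog.setup N X ⟨fun _ _ => 0, fun _ => 0⟩ () σ tr → Execution N X 0 true σ tr
  | step {n : ℕ} {b : Bool} {σ σ' : PRState V} {tr tr' : List (Event V)} :
      Execution N X n true σ tr → Prog.iteration N X σ b σ' tr' →
        Execution N X (n + 1) b σ' (tr ++ tr')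

/-- The invariants of a state: (1) excesses and residual capacities are non-negative, and all
excess is at vertices of `X`; (2) the labelling is valid; (4) labels are at most `2|X| - 1`. -/
structure Invariants {V : Type} [Fintype V] (N : Network V) (X : Finset V) (σ : PRState V) :
    Prop where
  preflow : N.IsPreflow σ.flow
  resCap_nonneg : ∀ u v, 0 ≤ N.resCap σ.flow u v
  excess_outside : ∀ v, v ∉ X → excess σ.flow v = 0
  label_src : σ.label N.src = X.card
  label_snk : σ.label N.snk = 0
  label_valid : ∀ u ∈ X, ∀ v ∈ X, N.ArcResidual X σ.flow u v → σ.label u ≤ σ.label v + 1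
  label_le : ∀ v ∈ X, σ.label v ≤ 2 * X.card - 1

/-- The properties of the individual operations: the invariants hold after each of them; labels
never decrease; after a Bulk-Push `(U, W)` each arc of `K^×` from `U` to `W` is saturated or its
tail is inactive; Relabel is applied only where it is applicable, assigns the label of its
definition, and strictly increases the label. -/
def Event.Correct {V : Type} [Fintype V] (N : Network V) (X : Finset V) : Event V → Prop
  | .access => True
  | .arcTest _ => True
  | .bulkPush U W σ σ' _ =>
      Invariants N X σ' ∧ (∀ v ∈ X, σ.label v ≤ σ'.label v) ∧
      ∀ u ∈ U, ∀ w ∈ W, ¬ N.ArcResidual X σ'.flow u w ∨ ¬ N.IsActive σ'.flow u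
  | .relabel u σ σ' =>
      N.IsActive σ.flow u ∧
      (∀ v ∈ X, N.ArcResidual X σ.flow u v → σ.label u ≤ σ.label v) ∧
      IsLeast {m | ∃ v ∈ X, N.ArcResidual X σ.flow u v ∧ m = σ.label v + 1} (σ'.label u) ∧
      Invariants N X σ' ∧ (∀ v ∈ X, σ.label v ≤ σ'.label v) ∧ σ.label u < σ'.label u

/-!
Why batch-highest-distance push-relabel on the complete graph `K` on `X` works.

*Validity.* For a threshold `θ`, call a vertex low if it belongs to `X` and has label at most `θ`,
or lies outside `X` and reaches such a vertex by a residual path avoiding `X` internally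
(`Network.Low`). Validity of the labels of `X` says that residual arcs from `X` into the low set
start at labels at most `θ + 1`. A Bulk-Push from label `m` to label `m - 1` cannot spoil this: a
cut argument with flow conservation shows that the pushed flow never goes from a low vertex to
one that is not low, so that no reverse arc leads into the low set
(`Network.IsBoundedFlow.valid_addFlow`). This needs no decomposition of the flow into paths, and it
covers circulations outside `X`. Since the pushed flow is maximum, an arc of `K` from a source that
is still active to a sink is saturated (`Network.IsMaxBoundedFlow.not_arcResidual`), so all residual
arcs of such a source lead to labels at least `m`, and Relabel applies to it.

*Gaps.* If no vertex of `X` has label `θ + 1`, no residual arc enters the low set. By counting, such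
a gap exists between `0` and `|X|`, which separates the source from the sink, so that a preflow
without active vertices is a maximum flow (`Network.Valid.isMaxFlow`). Another gap exists between
`|X|` and `2 |X|`; nothing can flow into the part above it, so that active vertices have labels at
most `2 |X| - 1` (`Network.Valid.label_le_of_isActive`). The same argument shows that active
vertices have residual arcs (`Network.exists_arcResidual_of_isActive`).

*Counting.* Let `L` be the sum of the labels of `X`, which is at most `2 |X| ^ 2`. Each Relabel
increases `L`. An iteration without Relabel leaves all its sources inactive and hence decreases the
largest label `h` of an active vertex, while in any other iteration `h` grows at most as much as
`L`. So `2 L - h` grows in every iteration (`ExecutionInvariant`), which bounds the number of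
iterations by `O(|X| ^ 2)`; the running time follows by counting the events of each kind.
-/

/-! ### Flow algebra -/

section FlowAlgebra

variable {V : Type}

theorem addFlow_sub_addFlow (ρ η : V → V → ℝ) (u v : V) :
    addFlow ρ η u v - addFlow ρ η v u = ρ u v - ρ v u + (η u v - η v u) := by
  simp only [addFlow]
  rcases le_total 0 (ρ u v + η u v - ρ v u - η v u) with h | h
  · rw [max_eq_right h, max_eq_left (by linarith)]; ring
  · rw [max_eq_left h, max_eq_right (by linarith)]; ring

theorem Network.resCap_addFlow (N : Network V) (ρ η : V → V → ℝ) (u v : V) :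
    N.resCap (addFlow ρ η) u v = N.resCap ρ u v - η u v + η v u := by
  have := addFlow_sub_addFlow ρ η u v
  simp only [Network.resCap]
  linarith

variable [Fintype V]

theorem excess_eq_sum_sub (ρ : V → V → ℝ) (v : V) : excess ρ v = ∑ u, (ρ u v - ρ v u) := by
  simp [excess, Finset.sum_sub_distrib]

/-- The excess of a vertex set is the net flow across its boundary. -/
theorem sum_excess_eq_boundary [DecidableEq V] (ρ : V → V → ℝ) (S : Finset V) :
    ∑ x ∈ S, excess ρ x = ∑ x ∈ S, ∑ y ∈ Sᶜ, (ρ y x - ρ x y) := by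
  have h : ∑ x ∈ S, ∑ y ∈ S, (ρ y x - ρ x y) = 0 := by
    simp only [Finset.sum_sub_distrib]
    rw [Finset.sum_comm, sub_self]
  simp only [excess_eq_sum_sub, ← Finset.sum_add_sum_compl S, Finset.sum_add_distrib, h, zero_add]

/-- If a set has no excess in total and nothing enters it, then nothing leaves it. -/
theorem eq_zero_of_no_inflow [DecidableEq V] {ρ : V → V → ℝ} (hρ : ∀ u v, 0 ≤ ρ u v)
    {S : Finset V} (hex : ∀ x ∈ S, excess ρ x = 0) (hin : ∀ x ∈ S, ∀ y ∉ S, ρ y x = 0)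
    {x y : V} (hx : x ∈ S) (hy : y ∉ S) : ρ x y = 0 := by
  have h := sum_excess_eq_boundary ρ S
  rw [Finset.sum_eq_zero hex] at h
  have h2 : ∑ x ∈ S, ∑ y ∈ Sᶜ, ρ x y = 0 := by
    rw [← neg_eq_zero, h, ← Finset.sum_neg_distrib]
    refine Finset.sum_congr rfl fun x hx => ?_
    rw [← Finset.sum_neg_distrib]
    refine Finset.sum_congr rfl fun y hy => ?_
    rw [hin x hx y (Finset.mem_compl.1 hy), zero_sub]
  rw [Finset.sum_eq_zero_iff_of_nonneg
    fun x _ => Finset.sum_nonneg fun y _ => hρ x y] at h2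
  have h3 := h2 x hx
  rw [Finset.sum_eq_zero_iff_of_nonneg fun y _ => hρ x y] at h3
  exact h3 y (Finset.mem_compl.2 hy)

/-- If a set has no excess in total and nothing leaves it, then nothing enters it. -/
theorem eq_zero_of_no_outflow [DecidableEq V] {ρ : V → V → ℝ} (hρ : ∀ u v, 0 ≤ ρ u v)
    {S : Finset V} (hex : ∀ x ∈ S, excess ρ x = 0) (hout : ∀ x ∈ S, ∀ y ∉ S, ρ x y = 0)
    {x y : V} (hx : x ∈ S) (hy : y ∉ S) : ρ y x = 0 := by
  refine eq_zero_of_no_inflow (ρ := fun u v => ρ v u) (fun u v => hρ v u) (fun x hx => ?_)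
    hout hx hy
  have h := hex x hx
  simp only [excess] at h ⊢
  linarith

theorem excess_addFlow (ρ η : V → V → ℝ) (v : V) :
    excess (addFlow ρ η) v = excess ρ v + excess η v := by
  simp only [excess_eq_sum_sub, addFlow_sub_addFlow, Finset.sum_add_distrib]

theorem Network.IsPreflow.resCap_nonneg {N : Network V} {ρ : V → V → ℝ} (h : N.IsPreflow ρ)
    (u v : V) : 0 ≤ N.resCap ρ u v := by
  have h1 := h.le_cap u v
  have h2 := h.nonneg v u
  simp only [Network.resCap]
  linarith

/-- A set not containing the source which no residual arc leaves has no positive excess, since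
nothing flows into it. -/
theorem Network.IsPreflow.excess_le_zero_of_closed [DecidableEq V] {N : Network V}
    {ρ : V → V → ℝ} (h : N.IsPreflow ρ) {S : Finset V} (hs : N.src ∉ S)
    (hS : ∀ x ∈ S, ∀ y ∉ S, ¬ 0 < N.resCap ρ x y) {u : V} (hu : u ∈ S) : excess ρ u ≤ 0 := by
  have h1 : ∑ x ∈ S, excess ρ x ≤ 0 := by
    rw [sum_excess_eq_boundary]
    refine Finset.sum_nonpos fun x hx => Finset.sum_nonpos fun y hy => ?_
    have h1 := hS x hx y (Finset.mem_compl.1 hy)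
    have h2 := h.le_cap x y
    have h3 := h.nonneg x y
    simp only [Network.resCap] at h1
    linarith
  have h2 : excess ρ u ≤ ∑ x ∈ S, excess ρ x :=
    Finset.single_le_sum (f := fun x => excess ρ x)
      (fun x hx => h.excess_nonneg x fun e => hs (e ▸ hx)) hu
  exact h2.trans h1

/-- Weak duality: a flow all of whose residual arcs respect a cut is maximum. -/
theorem Network.IsFlow.isMaxFlow_of_cut [DecidableEq V] {N : Network V} {ρ : V → V → ℝ}
    (h : N.IsFlow ρ) {S : Finset V} (hs : N.src ∈ S) (ht : N.snk ∉ S)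
    (hS : ∀ x ∈ S, ∀ y ∉ S, ¬ 0 < N.resCap ρ x y) : N.IsMaxFlow ρ := by
  have key : ∀ ρ', N.IsFlow ρ' →
      N.value ρ' = ∑ x ∈ S, ∑ y ∈ Sᶜ, (ρ' x y - ρ' y x) := by
    intro ρ' h'
    have h1 : ∑ x ∈ S, excess ρ' x = excess ρ' N.src :=
      Finset.sum_eq_single_of_mem _ hs fun x hx hxs =>
        h'.excess_eq_zero x hxs fun e => ht (e ▸ hx)
    have h2 : N.value ρ' = - excess ρ' N.src := by simp [Network.value, excess]
    rw [h2, ← h1, sum_excess_eq_boundary, ← Finset.sum_neg_distrib]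
    refine Finset.sum_congr rfl fun x _ => ?_
    rw [← Finset.sum_neg_distrib]
    simp
  refine ⟨h, fun ρ' h' => ?_⟩
  rw [key ρ' h', key ρ h]
  refine Finset.sum_le_sum fun x hx => Finset.sum_le_sum fun y hy => ?_
  have h1 := hS x hx y (Finset.mem_compl.1 hy)
  have h2 := h'.le_cap x y
  have h3 := h'.nonneg y x
  simp only [Network.resCap] at h1
  linarith

end FlowAlgebra

/-! ### Residual paths and low sets -/

section LowSets

variable {V : Type}

/-- `v` can be reached from `u` by a nonempty path of `r`-arcs with no internal vertex in `X`. -/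
def Connects (X : Finset V) (r : V → V → Prop) (u v : V) : Prop :=
  ∃ l : List V, (∀ x ∈ l, x ∉ X) ∧ List.IsChain r (u :: (l ++ [v]))

theorem connects_iff {X : Finset V} {r : V → V → Prop} {u v : V} :
    Connects X r u v ↔ r u v ∨ ∃ y, y ∉ X ∧ r u y ∧ Connects X r y v := by
  constructor
  · rintro ⟨l, hl, hc⟩
    cases l with
    | nil => left; simpa using hc
    | cons y l =>
      rw [List.cons_append, List.isChain_cons_cons] at hc
      exact Or.inr ⟨y, hl y (by simp), hc.1, l, fun x hx => hl x (by simp [hx]), hc.2⟩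
  · rintro (h | ⟨y, hy, h, l, hl, hc⟩)
    · exact ⟨[], by simp, by simpa using h⟩
    · refine ⟨y :: l, ?_, ?_⟩
      · simpa using ⟨hy, hl⟩
      · rw [List.cons_append, List.isChain_cons_cons]
        exact ⟨h, hc⟩

theorem Connects.of_rel {X : Finset V} {r : V → V → Prop} {u v : V} (h : r u v) :
    Connects X r u v :=
  connects_iff.2 (Or.inl h)

theorem Connects.head {X : Finset V} {r : V → V → Prop} {u y v : V} (h : r u y) (hy : y ∉ X)
    (h' : Connects X r y v) : Connects X r u v :=
  connects_iff.2 (Or.inr ⟨y, hy, h, h'⟩)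

/-- Induction on a path from its last arc backwards. -/
theorem Connects.induction {X : Finset V} {r : V → V → Prop} {v : V} {P : V → Prop}
    (base : ∀ u, r u v → P u) (head : ∀ u y, r u y → y ∉ X → P y → P u) {u : V}
    (h : Connects X r u v) : P u := by
  obtain ⟨l, hl, hc⟩ := h
  induction l generalizing u with
  | nil => exact base u (by simpa using hc)
  | cons y l ih =>
    rw [List.cons_append, List.isChain_cons_cons] at hc
    exact head u y hc.1 (hl y (by simp)) (ih (fun x hx => hl x (by simp [hx])) hc.2)

namespace Network

/-- Residual arcs of the network itself. -/
def Res (N : Network V) (ρ : V → V → ℝ) (x y : V) : Prop := 0 < N.resCap ρ x y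

/-- The labelling `h` of `X` drops by at most one along residual arcs of the complete graph
on `X`. -/
def Valid (N : Network V) (X : Finset V) (ρ : V → V → ℝ) (h : V → ℕ) : Prop :=
  ∀ u ∈ X, ∀ v ∈ X, N.ArcResidual X ρ u v → h u ≤ h v + 1

/-- The vertices of `X` with label at most `θ`, and the vertices outside `X` from which such a
vertex can be reached by a residual path that avoids `X` internally. -/
def Low (N : Network V) (X : Finset V) (ρ : V → V → ℝ) (h : V → ℕ) (θ : ℕ) (x : V) : Prop :=
  (x ∈ X ∧ h x ≤ θ) ∨ (x ∉ X ∧ ∃ v ∈ X, h v ≤ θ ∧ Connects X (N.Res ρ) x v)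

variable {N : Network V} {X : Finset V} {ρ : V → V → ℝ} {h : V → ℕ} {θ : ℕ}

theorem low_iff_of_mem {x : V} (hx : x ∈ X) : N.Low X ρ h θ x ↔ h x ≤ θ := by
  simp [Low, hx]

theorem Low.exists_connects {x y : V} (hy : N.Low X ρ h θ y) (hr : N.Res ρ x y) :
    ∃ v ∈ X, h v ≤ θ ∧ Connects X (N.Res ρ) x v := by
  rcases hy with ⟨hyX, hy⟩ | ⟨hyX, v, hv, hvθ, hc⟩
  · exact ⟨y, hyX, hy, .of_rel hr⟩
  · exact ⟨v, hv, hvθ, .head hr hyX hc⟩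

theorem Low.of_res {x y : V} (hy : N.Low X ρ h θ y) (hr : N.Res ρ x y) (hx : x ∉ X) :
    N.Low X ρ h θ x :=
  Or.inr ⟨hx, hy.exists_connects hr⟩

theorem Valid.le_of_res_low (hv : N.Valid X ρ h) {x y : V} (hx : x ∈ X) (hr : N.Res ρ x y)
    (hy : N.Low X ρ h θ y) : h x ≤ θ + 1 := by
  obtain ⟨v, hvX, hvθ, hc⟩ := hy.exists_connects hr
  by_cases hxv : x = v
  · subst hxv; omega
  · exact (hv x hx v hvX ⟨hxv, hc⟩).trans (by omega)

/-- If no vertex of `X` has label `θ + 1`, no residual arc enters the low set from outside. -/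
theorem Valid.low_of_res (hv : N.Valid X ρ h) (hgap : ∀ x ∈ X, h x ≠ θ + 1) {x y : V}
    (hr : N.Res ρ x y) (hy : N.Low X ρ h θ y) : N.Low X ρ h θ x := by
  by_cases hx : x ∈ X
  · rw [low_iff_of_mem hx]
    have h1 := hv.le_of_res_low hx hr hy
    have h2 := hgap x hx
    omega
  · exact hy.of_res hr hx

/-- Beyond a gap in the labels that lies above the source there is no excess. -/
theorem Valid.label_le_of_gap [Fintype V] [DecidableEq V] (hv : N.Valid X ρ h)
    (hρ : N.IsPreflow ρ) (hgap : ∀ x ∈ X, h x ≠ θ + 1) (hsX : N.src ∈ X) (hs : h N.src ≤ θ)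
    {u : V} (hu : u ∈ X) (hact : N.IsActive ρ u) : h u ≤ θ := by
  classical
  by_contra hlt
  have := hρ.excess_le_zero_of_closed (S := Finset.univ.filter fun x => ¬ N.Low X ρ h θ x) (u := u)
    (by simp [low_iff_of_mem hsX, hs])
    (fun x hx y hy hr => by
      simp only [Finset.mem_filter, Finset.mem_univ, true_and, not_not] at hx hy
      exact hx (hv.low_of_res hgap hr hy))
    (by simpa [low_iff_of_mem hu] using hlt)
  exact absurd hact.2.2 (not_lt.2 this)

/-- Among `|X| - 1` consecutive positive labels one is missing on `X`, if `s` and `t` do not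
use any of them. -/
theorem exists_label_gap [DecidableEq V] {s t : V} (hst : s ≠ t) (hs : s ∈ X) (ht : t ∈ X)
    (n : ℕ) (hns : h s ∉ Finset.Icc (n + 1) (n + X.card - 1))
    (hnt : h t ∉ Finset.Icc (n + 1) (n + X.card - 1)) :
    ∃ θ, n ≤ θ ∧ θ + 1 < n + X.card ∧ ∀ x ∈ X, h x ≠ θ + 1 := by
  have hc : (((X.erase s).erase t).image h).card < (Finset.Icc (n + 1) (n + X.card - 1)).card := by
    refine Finset.card_image_le.trans_lt ?_
    have ht' : t ∈ X.erase s := Finset.mem_erase.2 ⟨hst.symm, ht⟩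
    have h1 := Finset.card_erase_add_one hs
    have h2 := Finset.card_erase_add_one ht'
    rw [Nat.card_Icc]
    omega
  obtain ⟨g, hg, hg'⟩ := Finset.exists_mem_notMem_of_card_lt_card hc
  have hg2 := Finset.mem_Icc.1 hg
  refine ⟨g - 1, by omega, by omega, fun x hx hxg => ?_⟩
  have hxg' : h x = g := by omega
  by_cases hxs : x = s
  · subst hxs; exact hns (hxg' ▸ hg)
  by_cases hxt : x = t
  · subst hxt; exact hnt (hxg' ▸ hg)
  exact hg' (Finset.mem_image.2 ⟨x, by simp [hxs, hxt, hx], hxg'⟩)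

theorem Valid.label_le_of_isActive [Fintype V] [DecidableEq V] (hv : N.Valid X ρ h)
    (hρ : N.IsPreflow ρ) (hsX : N.src ∈ X) (htX : N.snk ∈ X) (hs : h N.src = X.card)
    (ht : h N.snk = 0) {u : V} (hu : u ∈ X) (hact : N.IsActive ρ u) :
    h u ≤ 2 * X.card - 1 := by
  obtain ⟨θ, h1, h2, h3⟩ := exists_label_gap (h := h) N.src_ne_snk hsX htX X.card
    (by simp [hs]) (by simp [ht])
  have := hv.label_le_of_gap hρ h3 hsX (by omega) hu hact
  omega

/-- The source cannot reach the sink in the residual graph, because of a gap in the labels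
between `0` and `|X|`. -/
theorem Valid.isMaxFlow [Fintype V] [DecidableEq V] (hv : N.Valid X ρ h)
    (hρ : N.IsFlow ρ) (hsX : N.src ∈ X) (htX : N.snk ∈ X) (hs : h N.src = X.card)
    (ht : h N.snk = 0) : N.IsMaxFlow ρ := by
  classical
  obtain ⟨θ, h1, h2, h3⟩ := exists_label_gap (h := h) N.src_ne_snk hsX htX 0
    (by have := Finset.card_pos.2 ⟨_, hsX⟩; simp [hs]) (by simp [ht])
  refine hρ.isMaxFlow_of_cut (S := Finset.univ.filter fun x => ¬ N.Low X ρ h θ x)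
    (by simp [low_iff_of_mem hsX, hs]; omega) (by simp [low_iff_of_mem htX, ht])
    (fun x hx y hy hr => ?_)
  simp only [Finset.mem_filter, Finset.mem_univ, true_and, not_not] at hx hy
  exact hx (hv.low_of_res h3 hr hy)

/-- An active vertex has a residual arc, so that Relabel applies to it. -/
theorem exists_arcResidual_of_isActive [Fintype V] [DecidableEq V] (hρ : N.IsPreflow ρ)
    (hsX : N.src ∈ X) {u : V} (hu : u ∈ X) (hact : N.IsActive ρ u) :
    ∃ v ∈ X, N.ArcResidual X ρ u v := by
  by_contra! hno
  -- Otherwise `u` could be given the label `2` and all other vertices the label `0`.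
  have hv : N.Valid X ρ fun x => if x = u then 2 else 0 := by
    intro x hx y hy hr
    by_cases hxu : x = u
    · subst hxu; exact absurd hr (hno y hy)
    · simp [hxu]
  have := hv.label_le_of_gap (θ := 0) hρ (fun x _ => by by_cases hxu : x = u <;> simp [hxu])
    hsX (by simp [hact.1.symm]) hu hact
  simp at this

end Network

end LowSets

/-! ### Bulk-Push -/

section BulkPush

variable {V : Type} [Fintype V] [DecidableEq V]

/-- A residual path carries a unit flow, obtained by adding up its arcs with multiplicity. -/
theorem Connects.exists_unit_flow {X : Finset V} {r : V → V → Prop} {u v : V}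
    (h : Connects X r u v) :
    ∃ p : V → V → ℝ, (∀ x y, 0 ≤ p x y) ∧
      (∀ x y, 0 < p x y → r x y ∧ (x = u ∨ x ∉ X) ∧ (y = v ∨ y ∉ X)) ∧
      ∀ x, excess p x = (if x = v then 1 else 0) - (if x = u then 1 else 0) := by
  have single : ∀ a b : V, ∀ x,
      excess (fun x y => if x = a ∧ y = b then (1 : ℝ) else 0) x
        = (if x = b then 1 else 0) - (if x = a then 1 else 0) := by
    intro a b x
    simp [excess, ite_and]
  refine h.induction (P := fun u => ∃ p : V → V → ℝ, (∀ x y, 0 ≤ p x y) ∧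
      (∀ x y, 0 < p x y → r x y ∧ (x = u ∨ x ∉ X) ∧ (y = v ∨ y ∉ X)) ∧
      ∀ x, excess p x = (if x = v then 1 else 0) - (if x = u then 1 else 0)) ?_ ?_
  · intro u hr
    refine ⟨fun x y => if x = u ∧ y = v then 1 else 0, fun x y => ?_, fun x y hp => ?_,
      single u v⟩
    · dsimp only; split_ifs <;> norm_num
    · dsimp only at hp
      split_ifs at hp with hxy
      · obtain ⟨rfl, rfl⟩ := hxy; exact ⟨hr, .inl rfl, .inl rfl⟩
      · exact absurd hp (lt_irrefl _)
  · rintro u y hr hy ⟨p, hp0, hp, hpe⟩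
    refine ⟨fun a b => (if a = u ∧ b = y then 1 else 0) + p a b, fun a b => ?_,
      fun a b hab => ?_, fun x => ?_⟩
    · have := hp0 a b
      dsimp only; split_ifs <;> linarith
    · dsimp only at hab
      split_ifs at hab with hxy
      · obtain ⟨rfl, rfl⟩ := hxy; exact ⟨hr, .inl rfl, .inr hy⟩
      · obtain ⟨h1, h2, h3⟩ := hp a b (by linarith)
        refine ⟨h1, .inr ?_, h3⟩
        rcases h2 with rfl | h2
        · exact hy
        · exact h2
    · have h1 := single u y x
      have h2 := hpe x
      simp only [excess, Finset.sum_add_distrib] at h1 h2 ⊢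
      linarith

namespace Network

variable {N : Network V} {X U W : Finset V} {ρ η : V → V → ℝ} {lim : V → WithTop ℝ}

theorem IsBoundedFlow.mem_of_pos (hη : N.IsBoundedFlow X ρ U W lim η) {x y : V}
    (h : 0 < η x y) : (x ∈ X → x ∈ U) ∧ (y ∈ X → y ∈ W) := by
  constructor
  · intro hx
    by_contra hU
    by_cases hW : x ∈ W
    · exact h.ne' (hη.sink_no_out x hW y)
    · exact h.ne' (hη.deleted x y (.inl (by simp [hx, hU, hW])))
  · intro hy
    by_contra hW
    by_cases hU : y ∈ U
    · exact h.ne' (hη.source_no_in y hU x)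
    · exact h.ne' (hη.deleted x y (.inr (by simp [hy, hU, hW])))

theorem IsBoundedFlow.res_of_pos (hη : N.IsBoundedFlow X ρ U W lim η) {x y : V}
    (h : 0 < η x y) : N.Res ρ x y :=
  h.trans_le (hη.le_resCap x y)

/-- A residual arc after a push is residual before it, or pushed flow runs against it. -/
theorem IsBoundedFlow.res_or_pos (hη : N.IsBoundedFlow X ρ U W lim η) {x y : V}
    (h : N.Res (addFlow ρ η) x y) : N.Res ρ x y ∨ 0 < η y x := by
  simp only [Res, resCap_addFlow] at h ⊢
  by_contra! hc
  have := hη.nonneg x y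
  linarith

theorem IsBoundedFlow.excess_source (hη : N.IsBoundedFlow X ρ U W lim η) {u : V} (hu : u ∈ U) :
    excess η u = - ∑ v, η u v := by
  simp [excess, Finset.sum_eq_zero fun v _ => hη.source_no_in u hu v]

theorem IsBoundedFlow.excess_nonneg_of_notMem (hη : N.IsBoundedFlow X ρ U W lim η) {v : V}
    (hv : v ∉ U) : 0 ≤ excess η v := by
  by_cases hW : v ∈ W
  · simp only [excess, Finset.sum_eq_zero fun x _ => hη.sink_no_out v hW x, sub_zero]
    exact Finset.sum_nonneg fun x _ => hη.nonneg x v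
  · exact (hη.conserved v (by simp [hv, hW])).ge

/-- A push keeps the preflow feasible if no source other than `s` sends more than its excess. -/
theorem IsBoundedFlow.isPreflow_addFlow (hη : N.IsBoundedFlow X ρ U W lim η)
    (hρ : N.IsPreflow ρ) (hlim : ∀ u ∈ U, u ≠ N.src → lim u ≤ (excess ρ u : WithTop ℝ)) :
    N.IsPreflow (addFlow ρ η) where
  nonneg _ _ := le_max_left _ _
  le_cap u v := by
    have h1 := hη.le_resCap u v
    have h2 := hη.nonneg v u
    refine max_le (N.cap_nonneg u v) ?_
    simp only [resCap] at h1
    linarith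
  excess_nonneg v hv := by
    have h0 := hρ.excess_nonneg v hv
    rw [excess_addFlow]
    by_cases hU : v ∈ U
    · have h1 := WithTop.coe_le_coe.1 ((hη.bounded v hU).trans (hlim v hU hv))
      rw [hη.excess_source hU]
      linarith
    · have := hη.excess_nonneg_of_notMem hU
      linarith

/-- Valid labels stay valid when flow is pushed from label `m` to label `m - 1`. For a vertex
outside `X`, being low for a threshold `θ` is not affected by the push: if `θ` is at least
`m - 1`, no pushed flow leaves the vertices outside `X` that are not low, and otherwise no pushed
flow enters the low ones; in both cases, by conservation, no pushed flow goes from a low vertex to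
one that is not low, so no residual arc arises in the opposite direction. -/
theorem IsBoundedFlow.valid_addFlow (hη : N.IsBoundedFlow X ρ U W lim η) {h : V → ℕ} {m : ℕ}
    (hv : N.Valid X ρ h) (hUX : U ⊆ X) (hWX : W ⊆ X) (hU : ∀ u ∈ U, h u = m)
    (hW : ∀ w ∈ W, h w + 1 = m) : N.Valid X (addFlow ρ η) h := by
  classical
  intro u hu v hvX ⟨huv, hc⟩
  set θ := h v with hθ
  let S : Finset V := Finset.univ.filter fun x => x ∉ X ∧ ¬ N.Low X ρ h θ x
  let T : Finset V := Finset.univ.filter fun x => x ∉ X ∧ N.Low X ρ h θ x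
  have hS : ∀ x, x ∈ S ↔ x ∉ X ∧ ¬ N.Low X ρ h θ x := by simp [S]
  have hT : ∀ x, x ∈ T ↔ x ∉ X ∧ N.Low X ρ h θ x := by simp [T]
  have hcons : ∀ x, x ∉ X → excess η x = 0 := fun x hx =>
    hη.conserved x fun hx' => hx ((Finset.union_subset hUX hWX) hx')
  -- Nothing is pushed out of `S`, as the sinks are low; by conservation nothing is pushed into it.
  have houtS : m ≤ θ + 1 → ∀ x ∈ S, ∀ y ∉ S, η y x = 0 := by
    intro hm x hx y hy
    refine eq_zero_of_no_outflow hη.nonneg (fun x hx => hcons x ((hS x).1 hx).1) ?_ hx hy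
    intro x hx y hy
    by_contra hne
    have hpos := (hη.nonneg x y).lt_of_ne' hne
    rw [hS] at hx hy
    have hy' : N.Low X ρ h θ y := by
      by_cases hyX : y ∈ X
      · have := hW y ((hη.mem_of_pos hpos).2 hyX)
        rw [low_iff_of_mem hyX]
        omega
      · by_contra hl; exact hy ⟨hyX, hl⟩
    exact hx.2 (hy'.of_res (hη.res_of_pos hpos) hx.1)
  -- Nothing is pushed into `T`, as the labels of the sources are too large for arcs into the low
  -- set; by conservation nothing is pushed out of it.
  have hinT : θ + 1 < m → ∀ x ∈ T, ∀ y ∉ T, η x y = 0 := by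
    intro hm x hx y hy
    refine eq_zero_of_no_inflow hη.nonneg (fun x hx => hcons x ((hT x).1 hx).1) ?_ hx hy
    intro x hx y hy
    by_contra hne
    have hpos := (hη.nonneg y x).lt_of_ne' hne
    rw [hT] at hx hy
    by_cases hyX : y ∈ X
    · have h1 := hU y ((hη.mem_of_pos hpos).1 hyX)
      have h2 := hv.le_of_res_low hyX (hη.res_of_pos hpos) hx.2
      omega
    · exact hy ⟨hyX, hx.2.of_res (hη.res_of_pos hpos) hyX⟩
  -- Residual arcs of the new preflow respect the low set of the old one.
  have hlow : ∀ x y, N.Res (addFlow ρ η) x y → N.Low X ρ h θ y → x ∉ X →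
      N.Low X ρ h θ x := by
    intro x y hr hy hx
    rcases hη.res_or_pos hr with hr | hpos
    · exact hy.of_res hr hx
    by_contra hxl
    by_cases hm : m ≤ θ + 1
    · exact hpos.ne' (houtS hm x ((hS x).2 ⟨hx, hxl⟩) y fun hyS => ((hS y).1 hyS).2 hy)
    · by_cases hyX : y ∈ X
      · have h1 := hU y ((hη.mem_of_pos hpos).1 hyX)
        rw [low_iff_of_mem hyX] at hy
        omega
      · exact hpos.ne' (hinT (by omega) y ((hT y).2 ⟨hyX, hy⟩) x fun hxT => hxl ((hT x).1 hxT).2)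
  have hle : ∀ x y, N.Res (addFlow ρ η) x y → N.Low X ρ h θ y → x ∈ X → h x ≤ θ + 1 := by
    intro x y hr hy hx
    rcases hη.res_or_pos hr with hr | hpos
    · exact hv.le_of_res_low hx hr hy
    have h1 := hW x ((hη.mem_of_pos hpos).2 hx)
    by_contra hlt
    by_cases hyX : y ∈ X
    · have h2 := hU y ((hη.mem_of_pos hpos).1 hyX)
      rw [low_iff_of_mem hyX] at hy
      omega
    · exact hpos.ne' (hinT (by omega) y ((hT y).2 ⟨hyX, hy⟩) x fun hxT => ((hT x).1 hxT).1 hx)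
  have hvlow : N.Low X ρ h θ v := (low_iff_of_mem hvX).2 le_rfl
  rcases connects_iff.1 hc with hr | ⟨y, hyX, hr, hc⟩
  · exact hle u v hr hvlow hu
  · refine hle u y hr (hc.induction (P := fun y => y ∉ X → N.Low X ρ h θ y) ?_ ?_ hyX) hu
    · exact fun x hr hx => hlow x v hr hvlow hx
    · exact fun x y hr hy ih hx => hlow x y hr (ih hy) hx

/-- After a push of maximum value, a source from which an arc to a sink is still residual has
used up its limit: otherwise a small amount could be sent along that arc in addition. -/
theorem IsMaxBoundedFlow.not_arcResidual (hη : N.IsMaxBoundedFlow X ρ U W lim η) (hUX : U ⊆ X)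
    (hWX : W ⊆ X) (hUW : Disjoint U W) {u w : V} (hu : u ∈ U) (hw : w ∈ W) {ε : ℝ} (hε : 0 < ε)
    (hlim : ((∑ v, η u v + ε : ℝ) : WithTop ℝ) ≤ lim u) :
    ¬ N.ArcResidual X (addFlow ρ η) u w := by
  rintro ⟨-, hc⟩
  obtain ⟨hη, hmax⟩ := hη
  obtain ⟨p, hp0, hp, hpe⟩ := Connects.exists_unit_flow hc
  -- An amount that fits through all arcs of the path.
  obtain ⟨δ, hδ0, hδε, hδ⟩ : ∃ δ : ℝ, 0 < δ ∧ δ ≤ ε ∧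
      ∀ x y, 0 < p x y → δ * p x y ≤ N.resCap (addFlow ρ η) x y := by
    have h1 : ∀ᶠ δ in nhdsWithin (0 : ℝ) (Set.Ioi 0), ∀ x y, 0 < p x y →
        δ * p x y ≤ N.resCap (addFlow ρ η) x y := by
      refine Filter.eventually_all.2 fun x => Filter.eventually_all.2 fun y => ?_
      by_cases hxy : 0 < p x y
      · have ht : Filter.Tendsto (fun δ : ℝ => δ * p x y) (nhdsWithin 0 (Set.Ioi 0)) (nhds 0) := by
          have : Filter.Tendsto (fun δ : ℝ => δ * p x y) (nhds 0) (nhds (0 * p x y)) :=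
            (continuous_id.mul continuous_const).tendsto 0
          rw [zero_mul] at this
          exact this.mono_left nhdsWithin_le_nhds
        filter_upwards [ht.eventually (gt_mem_nhds (hp x y hxy).1)] with δ hδ _ using hδ.le
      · exact Filter.Eventually.of_forall fun δ h => absurd h hxy
    have h2 : ∀ᶠ δ in nhdsWithin (0 : ℝ) (Set.Ioi 0), δ ∈ Set.Ioc 0 ε :=
      Ioc_mem_nhdsGT hε
    obtain ⟨δ, h3, h4⟩ := (h1.and h2).exists
    exact ⟨δ, h4.1, h4.2, h3⟩
  have hpz : ∀ x y, ¬ 0 < p x y → p x y = 0 := fun x y h => le_antisymm (not_lt.1 h) (hp0 x y)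
  have hpout : ∀ x y, x ∈ X → x ≠ u → p x y = 0 := fun x y hx hxu =>
    hpz x y fun h => ((hp x y h).2.1).elim hxu fun h => h hx
  have hpin : ∀ x y, y ∈ X → y ≠ w → p x y = 0 := fun x y hy hyw =>
    hpz x y fun h => ((hp x y h).2.2).elim hyw fun h => h hy
  have huw : ∀ x ∈ U, x ≠ w := fun x hx e => Finset.disjoint_left.1 hUW hx (e ▸ hw)
  have hwu : ∀ x ∈ W, x ≠ u := fun x hx e => Finset.disjoint_left.1 hUW hu (e ▸ hx)
  let δp : V → V → ℝ := fun x y => δ * p x y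
  have hδp : ∀ x y, 0 ≤ δp x y := fun x y => mul_nonneg hδ0.le (hp0 x y)
  have hex : ∀ x, excess (addFlow η δp) x
      = excess η x + δ * ((if x = w then 1 else 0) - (if x = u then 1 else 0)) := by
    intro x
    rw [excess_addFlow, ← hpe x]
    simp [δp, excess, Finset.mul_sum, mul_sub]
  have hnoin : ∀ x ∈ U, ∀ y, addFlow η δp y x = 0 := by
    intro x hx y
    refine max_eq_left ?_
    have h1 := hη.source_no_in x hx y
    have h2 : δp y x = 0 := by simp [δp, hpin y x (hUX hx) (huw x hx)]
    have h3 := hη.nonneg x y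
    have h4 := hδp x y
    linarith
  have hout : ∀ x ∈ U, ∑ y, addFlow η δp x y = ∑ y, η x y + δ * (if x = u then 1 else 0) := by
    intro x hx
    have h1 := hex x
    rw [hη.excess_source hx, excess, Finset.sum_eq_zero fun y _ => hnoin x hx y,
      if_neg (huw x hx)] at h1
    linarith
  have hnew : N.IsBoundedFlow X ρ U W lim (addFlow η δp) :=
    { nonneg := fun _ _ => le_max_left _ _
      le_resCap := by
        intro x y
        have h0 := hη.nonneg x y
        have h1 := hη.le_resCap x y
        have h2 := hη.nonneg y x
        have h3 := hδp y x
        refine max_le (h0.trans h1) ?_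
        by_cases hxy : 0 < p x y
        · have h4 := hδ x y hxy
          rw [resCap_addFlow] at h4
          simp only [δp] at h3 ⊢
          linarith
        · have h4 : δp x y = 0 := by simp [δp, hpz x y hxy]
          linarith
      deleted := by
        intro x y hxy
        have h1 := hη.deleted x y hxy
        have h2 := hη.deleted y x hxy.symm
        have key : ∀ x y, x ∈ X \ (U ∪ W) → δp x y = 0 ∧ δp y x = 0 := by
          intro x y hx
          simp only [Finset.mem_sdiff, Finset.mem_union, not_or] at hx
          exact ⟨by simp [δp, hpout x y hx.1 fun e => hx.2.1 (e ▸ hu)],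
            by simp [δp, hpin y x hx.1 fun e => hx.2.2 (e ▸ hw)]⟩
        have h3 : δp x y = 0 ∧ δp y x = 0 := hxy.elim (key x y) fun h => (key y x h).symm
        simp [addFlow, h1, h2, h3]
      conserved := by
        intro x hx
        have h1 : x ≠ w := fun e => hx (by simp [e, hw])
        have h2 : x ≠ u := fun e => hx (by simp [e, hu])
        simp [hex, hη.conserved x hx, h1, h2]
      source_no_in := hnoin
      sink_no_out := by
        intro x hx y
        refine max_eq_left ?_
        have h1 := hη.sink_no_out x hx y
        have h2 : δp x y = 0 := by simp [δp, hpout x y (hWX hx) (hwu x hx)]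
        have h3 := hη.nonneg y x
        have h4 := hδp y x
        linarith
      bounded := by
        intro x hx
        rw [hout x hx]
        by_cases hxu : x = u
        · subst hxu
          refine le_trans (WithTop.coe_le_coe.2 ?_) hlim
          simpa using hδε
        · simpa [hxu] using hη.bounded x hx }
  have h1 := hmax _ hnew
  rw [Finset.sum_congr rfl hout, Finset.sum_add_distrib, ← Finset.mul_sum,
    Finset.sum_ite_eq' U u, if_pos hu] at h1
  linarith

/-- Maximum flows exist, because the feasible ones form a compact set. -/
theorem exists_isMaxBoundedFlow (hρ : ∀ x y, 0 ≤ N.resCap ρ x y) (hlim : ∀ u ∈ U, 0 ≤ lim u) :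
    ∃ η, N.IsMaxBoundedFlow X ρ U W lim η := by
  have hclosed : IsClosed {η | N.IsBoundedFlow X ρ U W lim η} := by
    have hb : ∀ u, IsClosed {η : V → V → ℝ | ((∑ v, η u v : ℝ) : WithTop ℝ) ≤ lim u} := by
      intro u
      induction lim u using WithTop.recTopCoe with
      | top => simp
      | coe a =>
        simp only [WithTop.coe_le_coe]
        exact isClosed_le (by fun_prop) continuous_const
    have : {η | N.IsBoundedFlow X ρ U W lim η} =
        {η | (∀ u v, 0 ≤ η u v) ∧ (∀ u v, η u v ≤ N.resCap ρ u v) ∧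
          (∀ u v, u ∈ X \ (U ∪ W) ∨ v ∈ X \ (U ∪ W) → η u v = 0) ∧
          (∀ v, v ∉ U ∪ W → excess η v = 0) ∧ (∀ u ∈ U, ∀ v, η v u = 0) ∧
          (∀ w ∈ W, ∀ v, η w v = 0) ∧
          ∀ u ∈ U, ((∑ v, η u v : ℝ) : WithTop ℝ) ≤ lim u} :=
      Set.ext fun η => ⟨fun h => ⟨h.1, h.2, h.3, h.4, h.5, h.6, h.7⟩,
        fun ⟨h1, h2, h3, h4, h5, h6, h7⟩ => ⟨h1, h2, h3, h4, h5, h6, h7⟩⟩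
    rw [this]
    simp only [Set.ofPred_and, Set.ofPred_forall, excess]
    have hz : ∀ f : (V → V → ℝ) → ℝ, Continuous f → IsClosed {η | f η = 0} := fun f hf =>
      isClosed_eq hf continuous_const
    refine .inter ?_ (.inter ?_ (.inter ?_ (.inter ?_ (.inter ?_ (.inter ?_ ?_)))))
    · exact isClosed_iInter fun u => isClosed_iInter fun v =>
        isClosed_le continuous_const (by fun_prop)
    · exact isClosed_iInter fun u => isClosed_iInter fun v =>
        isClosed_le (by fun_prop) continuous_const
    · exact isClosed_iInter fun u => isClosed_iInter fun v => isClosed_iInter fun _ =>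
        hz _ (by fun_prop)
    · exact isClosed_iInter fun u => isClosed_iInter fun _ => hz _ (by fun_prop)
    · exact isClosed_iInter fun u => isClosed_iInter fun _ => isClosed_iInter fun v =>
        hz _ (by fun_prop)
    · exact isClosed_iInter fun u => isClosed_iInter fun _ => isClosed_iInter fun v =>
        hz _ (by fun_prop)
    · exact isClosed_iInter fun u => isClosed_iInter fun _ => hb u
  have hcompact : IsCompact {η | N.IsBoundedFlow X ρ U W lim η} :=
    (isCompact_Icc (a := fun _ _ => (0 : ℝ)) (b := fun x y => N.resCap ρ x y)).of_isClosed_subset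
      hclosed fun η hη => ⟨fun x y => hη.nonneg x y, fun x y => hη.le_resCap x y⟩
  have hzero : N.IsBoundedFlow X ρ U W lim fun _ _ => 0 :=
    { nonneg := by simp
      le_resCap := hρ
      deleted := by simp
      conserved := by simp [excess]
      source_no_in := by simp
      sink_no_out := by simp
      bounded := by simpa using hlim }
  obtain ⟨η, hη, hmax⟩ := hcompact.exists_isMaxOn (f := fun η => ∑ u ∈ U, ∑ v, η u v) ⟨_, hzero⟩
    (by fun_prop)
  exact ⟨η, hη, fun η' hη' => hmax hη'⟩

end Network

end BulkPush

/-! ### Reasoning about programs -/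

section Programs

variable {V : Type}

/-- Accesses to excesses and labels. -/
def Event.isAccess : Event V → Bool
  | access => true
  | _ => false

/-- The trace contains at most `acc` accesses, `arc` arc tests and `bp` calls of Bulk-Push, and
exactly `rel` calls of Relabel. -/
structure TraceCounts (tr : List (Event V)) (acc arc bp rel : ℕ) : Prop where
  access_le : tr.countP Event.isAccess ≤ acc
  arcTest_le : tr.countP Event.isArcTest ≤ arc
  bulkPush_le : tr.countP Event.isBulkPush ≤ bp
  relabel_eq : tr.countP Event.isRelabel = rel

theorem TraceCounts.append {tr tr' : List (Event V)} {a b c d a' b' c' d' : ℕ}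
    (h : TraceCounts tr a b c d) (h' : TraceCounts tr' a' b' c' d') :
    TraceCounts (tr ++ tr') (a + a') (b + b') (c + c') (d + d') := by
  obtain ⟨h1, h2, h3, h4⟩ := h
  obtain ⟨h1', h2', h3', h4'⟩ := h'
  constructor <;> rw [List.countP_append] <;> omega

theorem TraceCounts.mono {tr : List (Event V)} {a b c d a' b' c' : ℕ}
    (h : TraceCounts tr a b c d) (ha : a ≤ a') (hb : b ≤ b') (hc : c ≤ c') :
    TraceCounts tr a' b' c' d :=
  ⟨h.1.trans ha, h.2.trans hb, h.3.trans hc, h.4⟩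

theorem TraceCounts.nil : TraceCounts ([] : List (Event V)) 0 0 0 0 := by
  constructor <;> simp

theorem TraceCounts.replicate_access (n : ℕ) :
    TraceCounts (List.replicate n (Event.access : Event V)) n 0 0 0 := by
  constructor <;> simp [List.countP_replicate, Event.isAccess, Event.isArcTest,
    Event.isBulkPush, Event.isRelabel]

theorem TraceCounts.sum_time_le {tr : List (Event V)} {a b c d T q : ℕ}
    (h : TraceCounts tr a b c d) (hT : ∀ e ∈ tr, e.isBulkPush = true → e.time ≤ T)
    (hq : ∀ e ∈ tr, e.isArcTest = true → e.time ≤ q) :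
    (tr.map Event.time).sum ≤ a + b * q + c * T + d := by
  have key : (tr.map Event.time).sum ≤ tr.countP Event.isAccess + tr.countP Event.isArcTest * q +
      tr.countP Event.isBulkPush * T + tr.countP Event.isRelabel := by
    clear h
    induction tr with
    | nil => simp
    | cons e tr ih =>
      have ih' := ih (fun e he => hT e (by simp [he])) (fun e he => hq e (by simp [he]))
      have hTe := hT e (by simp)
      have hqe := hq e (by simp)
      cases e <;>
        simp only [List.map_cons, List.sum_cons, List.countP_cons, Event.isAccess,
          Event.isArcTest, Event.isBulkPush, Event.isRelabel, Event.time, if_true,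
          Bool.false_eq_true, if_false, add_zero, forall_true_left, add_mul, one_mul]
          at hTe hqe ⊢ <;> omega
  have h2 := Nat.mul_le_mul_right q h.arcTest_le
  have h3 := Nat.mul_le_mul_right T h.bulkPush_le
  have h1 := h.access_le
  have h4 := h.relabel_eq
  omega

theorem Event.correct_of_mem_replicate_access [Fintype V] {N : Network V} {X : Finset V} {n : ℕ} :
    ∀ e ∈ List.replicate n (Event.access : Event V), e.Correct N X := by
  intro e he
  rw [List.eq_of_mem_replicate he]
  trivial

namespace Prog

/-- Invariant rule for loops that compute a value; the invariant may refer to the list of the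
elements processed so far. -/
theorem foldlM_invariant {α β : Type} {f : β → α → Prog V β} {l : List α}
    (P : List α → β → PRState V → List (Event V) → Prop)
    (hstep : ∀ pre x post, l = pre ++ x :: post → ∀ b σ tr b' σ' tr', P pre b σ tr →
      f b x σ b' σ' tr' → P (pre ++ [x]) b' σ' (tr ++ tr'))
    {b b' : β} {σ σ' : PRState V} {tr : List (Event V)} (h0 : P [] b σ [])
    (h : l.foldlM f b σ b' σ' tr) : P l b' σ' tr := by
  suffices H : ∀ (post pre : List α), l = pre ++ post → ∀ b σ tr₀ tr, P pre b σ tr₀ →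
      post.foldlM f b σ b' σ' tr → P l b' σ' (tr₀ ++ tr) from
    H l [] rfl b σ [] tr h0 h
  intro post
  induction post with
  | nil =>
    rintro pre hl b σ tr₀ tr hP ⟨rfl, rfl, rfl⟩
    rw [List.append_nil] at hl ⊢
    exact hl ▸ hP
  | cons x post ih =>
    rintro pre hl b σ tr₀ tr hP hf
    rw [List.foldlM_cons] at hf
    obtain ⟨b₁, σ₁, t₁, t₂, h1, h2, rfl⟩ := hf
    rw [← List.append_assoc]
    exact ih (pre ++ [x]) (by simp [hl]) b₁ σ₁ _ _ (hstep pre x post hl _ _ _ _ _ _ hP h1) h2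

/-- Invariant rule for loops. -/
theorem forM_invariant {α : Type} {f : α → Prog V Unit} {l : List α}
    (P : List α → PRState V → List (Event V) → Prop)
    (hstep : ∀ pre x post, l = pre ++ x :: post → ∀ σ tr σ' tr', P pre σ tr →
      f x σ () σ' tr' → P (pre ++ [x]) σ' (tr ++ tr'))
    {σ σ' : PRState V} {tr : List (Event V)} (h0 : P [] σ [])
    (h : l.forM f σ () σ' tr) : P l σ' tr := by
  suffices H : ∀ (post pre : List α), l = pre ++ post → ∀ σ tr₀ tr, P pre σ tr₀ →
      post.forM f σ () σ' tr → P l σ' (tr₀ ++ tr) from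
    H l [] rfl σ [] tr h0 h
  intro post
  induction post with
  | nil =>
    rintro pre hl σ tr₀ tr hP ⟨-, rfl, rfl⟩
    rw [List.append_nil] at hl ⊢
    exact hl ▸ hP
  | cons x post ih =>
    rintro pre hl σ tr₀ tr hP ⟨b₁, σ₁, t₁, t₂, h1, h2, rfl⟩
    rw [← List.append_assoc]
    exact ih (pre ++ [x]) (by simp [hl]) σ₁ _ _ (hstep pre x post hl _ _ _ _ hP h1) h2

/-- Invariant rule for loops that do not change the state and use `c` accesses in each round. -/
theorem foldlM_readOnly {α β : Type} {f : β → α → Prog V β} {l : List α} {σ : PRState V}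
    (c : ℕ) (Q : List α → β → Prop)
    (hstep : ∀ pre x b b' σ' tr', Q pre b → f b x σ b' σ' tr' →
      Q (pre ++ [x]) b' ∧ σ' = σ ∧ tr' = List.replicate c Event.access)
    {b b' : β} {σ' : PRState V} {tr : List (Event V)} (h0 : Q [] b)
    (h : l.foldlM f b σ b' σ' tr) :
    Q l b' ∧ σ' = σ ∧ tr = List.replicate (c * l.length) Event.access := by
  refine foldlM_invariant (fun pre b σ' tr =>
    Q pre b ∧ σ' = σ ∧ tr = List.replicate (c * pre.length) Event.access) ?_ ⟨h0, rfl, rfl⟩ h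
  rintro pre x post - b σ' tr b' σ'' tr' ⟨hQ, rfl, rfl⟩ hf
  obtain ⟨h1, h2, rfl⟩ := hstep pre x b b' σ'' tr' hQ hf
  exact ⟨h1, h2, by
    rw [List.length_append, List.length_singleton, mul_add, mul_one, List.replicate_add]⟩

/-- From every state the program can run to completion. -/
def Total {α : Type} (p : Prog V α) : Prop :=
  ∀ σ, ∃ a σ' tr, p σ a σ' tr

theorem Total.pure {α : Type} (a : α) : Total (pure a : Prog V α) :=
  fun σ => ⟨a, σ, [], rfl, rfl, rfl⟩

theorem Total.bind {α β : Type} {p : Prog V α} {f : α → Prog V β} (hp : Total p)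
    (hf : ∀ a, Total (f a)) : Total (p >>= f) := by
  intro σ
  obtain ⟨a, σ₁, t₁, h1⟩ := hp σ
  obtain ⟨b, σ₂, t₂, h2⟩ := hf a σ₁
  exact ⟨b, σ₂, _, a, σ₁, t₁, t₂, h1, h2, rfl⟩

theorem Total.foldlM {α β : Type} {f : β → α → Prog V β} (hf : ∀ b x, Total (f b x))
    (l : List α) (b : β) : Total (l.foldlM f b) := by
  induction l generalizing b with
  | nil => exact Total.pure b
  | cons x l ih =>
    rw [List.foldlM_cons]
    exact (hf b x).bind fun b' => ih b'

theorem Total.forM {α : Type} {f : α → Prog V Unit} (hf : ∀ x, Total (f x))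
    (l : List α) : Total (l.forM f) := by
  induction l with
  | nil => exact Total.pure ()
  | cons x l ih => exact (hf x).bind fun _ => ih

theorem total_enum [DecidableEq V] (S : Finset V) : Total (enum S) :=
  fun σ => ⟨S.toList, σ, [], S.nodup_toList, S.toList_toFinset, rfl, rfl⟩

theorem total_readExcess [Fintype V] (v : V) : Total (readExcess v) :=
  fun σ => ⟨_, σ, _, rfl, rfl, rfl⟩

theorem total_readLabel (v : V) : Total (readLabel v) :=
  fun σ => ⟨_, σ, _, rfl, rfl, rfl⟩

theorem total_writeLabel [DecidableEq V] (v : V) (n : ℕ) : Total (writeLabel v n) :=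
  fun _ => ⟨(), _, _, rfl, rfl⟩

theorem total_assignLabel [DecidableEq V] (v : V) (n : ℕ) : Total (assignLabel v n) :=
  fun _ => ⟨(), _, _, rfl, rfl⟩

theorem total_testArc (N : Network V) (X : Finset V) (u v : V) : Total (testArc N X u v) := by
  classical
  exact fun σ => ⟨decide (N.ArcResidual X σ.flow u v), σ, _, by simp, rfl, 0, rfl⟩

/-- The loop of Relabel computes the least label at the other end of a residual arc. -/
theorem relabel_loop_spec [Fintype V] (N : Network V) (X : Finset V) {u : V} {l : List V}
    {σ σ' : PRState V} {r : Option ℕ} {tr : List (Event V)}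
    (h : (l.foldlM (fun (m : Option ℕ) v => do
      let b ← testArc N X u v
      let n ← readLabel v
      pure (if b then some (min n (m.getD n)) else m)) none : Prog V (Option ℕ)) σ r σ' tr) :
    (r = none → ∀ v ∈ l, ¬ N.ArcResidual X σ.flow u v) ∧
    (∀ m, r = some m → (∃ v ∈ l, N.ArcResidual X σ.flow u v ∧ σ.label v = m) ∧
        ∀ v ∈ l, N.ArcResidual X σ.flow u v → m ≤ σ.label v) ∧
    σ' = σ ∧ TraceCounts tr l.length l.length 0 0 ∧ ∀ e ∈ tr, e.Correct N X := by
  refine foldlM_invariant (fun pre r σ' tr =>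
    (r = none → ∀ v ∈ pre, ¬ N.ArcResidual X σ.flow u v) ∧
    (∀ m, r = some m → (∃ v ∈ pre, N.ArcResidual X σ.flow u v ∧ σ.label v = m) ∧
        ∀ v ∈ pre, N.ArcResidual X σ.flow u v → m ≤ σ.label v) ∧
    σ' = σ ∧ TraceCounts tr pre.length pre.length 0 0 ∧ ∀ e ∈ tr, e.Correct N X) ?_ ?_ h
  · clear h
    rintro pre x post - r _ tr _ σ₁ _ ⟨hQ1, hQ2, rfl, hc, hcor⟩
      ⟨b, _, _, _, ⟨hb, rfl, c, rfl⟩, ⟨_, _, _, _, ⟨rfl, rfl, rfl⟩, ⟨rfl, rfl, rfl⟩, rfl⟩, rfl⟩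
    rw [← and_assoc]
    constructor
    · by_cases hx : b = true
      · rw [if_pos hx]
        rw [hb] at hx
        refine ⟨by simp, fun m hm => ?_⟩
        rw [Option.some_inj] at hm
        cases r with
        | none =>
          simp only [Option.getD_none] at hm
          have hQ := hQ1 rfl
          refine ⟨⟨x, by simp, hx, by omega⟩, fun v hv hva => ?_⟩
          rcases List.mem_append.1 hv with hv | hv
          · exact absurd hva (hQ v hv)
          · rw [List.mem_singleton.1 hv]; omega
        | some n =>
          simp only [Option.getD_some] at hm
          obtain ⟨⟨w, hw, hwa, hwl⟩, hQ⟩ := hQ2 n rfl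
          constructor
          · rcases le_total n (σ₁.label x) with hle | hle
            · exact ⟨w, by simp [hw], hwa, by omega⟩
            · exact ⟨x, by simp, hx, by omega⟩
          · intro v hv hva
            rcases List.mem_append.1 hv with hv | hv
            · have := hQ v hv hva; omega
            · rw [List.mem_singleton.1 hv]; omega
      · rw [if_neg hx]
        rw [hb] at hx
        constructor
        · intro hr v hv
          rcases List.mem_append.1 hv with hv | hv
          · exact hQ1 hr v hv
          · rwa [List.mem_singleton.1 hv]
        · intro m hm
          obtain ⟨⟨w, hw, hwa⟩, hQ⟩ := hQ2 m hm
          refine ⟨⟨w, by simp [hw], hwa⟩, fun v hv hva => ?_⟩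
          rcases List.mem_append.1 hv with hv | hv
          · exact hQ v hv hva
          · rw [List.mem_singleton.1 hv] at hva; exact absurd hva hx
    · refine ⟨rfl, ?_, ?_⟩
      · rw [List.length_append]
        exact hc.append (a' := 1) (b' := 1) (c' := 0) (d' := 0) (by
          constructor <;> simp [List.countP_cons, Event.isAccess, Event.isArcTest,
            Event.isBulkPush, Event.isRelabel])
      · intro e he
        rcases List.mem_append.1 he with he | he
        · exact hcor e he
        · simp only [List.append_nil, List.cons_append, List.nil_append, List.mem_cons,
            List.not_mem_nil, or_false] at he
          rcases he with rfl | rfl <;> trivial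
  · exact ⟨by simp, by simp, rfl, .nil, by simp⟩

section

variable [DecidableEq V] (N : Network V) (X : Finset V)

theorem total_oneBelow (m : ℕ) : Total (oneBelow X m) :=
  (total_enum X).bind fun l => .foldlM (fun _ v => (total_readLabel v).bind fun _ => .pure _) l ∅

theorem total_relabel (u : V) : Total (relabel N X u) := by
  refine (total_enum _).bind fun l => (Total.foldlM (fun _ v => (total_testArc N X u v).bind
    fun _ => (total_readLabel v).bind fun _ => .pure _) l none).bind fun m => ?_
  cases m with
  | none => exact .pure ()
  | some n => exact total_assignLabel u (n + 1)

/-- A program that starts with an enumeration of `S` continues with some list of the elements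
of `S`. -/
theorem exists_list_of_enum_bind {S : Finset V} {β : Type} {f : List V → Prog V β}
    {σ σ' : PRState V} {b : β} {tr : List (Event V)} (h : (enum S >>= f) σ b σ' tr) :
    ∃ l : List V, l.Nodup ∧ (∀ x, x ∈ l ↔ x ∈ S) ∧ l.length = S.card ∧ f l σ b σ' tr := by
  obtain ⟨l, _, _, _, ⟨hnd, rfl, rfl, rfl⟩, h, rfl⟩ := h
  exact ⟨l, hnd, by simp, (List.toFinset_card_of_nodup hnd).symm, h⟩

theorem oneBelow_spec {m : ℕ} {σ σ' : PRState V} {W : Finset V} {tr : List (Event V)}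
    (h : oneBelow X m σ W σ' tr) :
    (∀ v, v ∈ W ↔ v ∈ X ∧ σ.label v + 1 = m) ∧
    σ' = σ ∧ tr = List.replicate X.card Event.access := by
  obtain ⟨l, hnd, hl, hlen, h⟩ := exists_list_of_enum_bind h
  rw [← hlen]
  simp only [← hl]
  rw [← one_mul l.length]
  refine foldlM_readOnly 1 (fun pre W => ∀ v, v ∈ W ↔ v ∈ pre ∧ σ.label v + 1 = m) ?_ ?_ h
  · rintro pre x S _ _ _ hQ ⟨_, _, _, _, ⟨rfl, rfl, rfl⟩, ⟨rfl, rfl, rfl⟩, rfl⟩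
    refine ⟨fun v => ?_, rfl, rfl⟩
    by_cases hvx : v = x <;> split_ifs with hx <;> simp [hQ, hvx, hx]
  · simp

end

section

variable [Fintype V] (N : Network V)

theorem total_testActive (v : V) : Total (testActive N v) :=
  (total_readExcess v).bind fun _ => .pure _

variable [DecidableEq V] (X : Finset V)

theorem total_maxActiveLabel : Total (maxActiveLabel N X) :=
  (total_enum X).bind fun l => .foldlM (fun _ v => (total_testActive N v).bind fun _ =>
    (total_readLabel v).bind fun _ => .pure _) l none

theorem total_activeWithLabel (m : ℕ) : Total (activeWithLabel N X m) :=
  (total_enum X).bind fun l => .foldlM (fun _ v => (total_testActive N v).bind fun _ =>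
    (total_readLabel v).bind fun _ => .pure _) l ∅

theorem testActive_spec {v : V} {σ σ' : PRState V} {b : Bool} {tr : List (Event V)}
    (h : testActive N v σ b σ' tr) :
    (b = true ↔ N.IsActive σ.flow v) ∧ σ' = σ ∧ tr = [Event.access] := by
  obtain ⟨_, _, _, _, ⟨rfl, rfl, rfl⟩, ⟨rfl, rfl, rfl⟩, rfl⟩ := h
  exact ⟨by simp [Network.IsActive], rfl, rfl⟩

theorem maxActiveLabel_spec {σ σ' : PRState V} {r : Option ℕ} {tr : List (Event V)}
    (h : maxActiveLabel N X σ r σ' tr) :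
    ((r = none → ∀ v ∈ X, ¬ N.IsActive σ.flow v) ∧
      ∀ m, r = some m → (∃ v ∈ X, N.IsActive σ.flow v ∧ σ.label v = m) ∧
        ∀ v ∈ X, N.IsActive σ.flow v → σ.label v ≤ m) ∧
    σ' = σ ∧ tr = List.replicate (2 * X.card) Event.access := by
  obtain ⟨l, hnd, hl, hlen, h⟩ := exists_list_of_enum_bind h
  rw [← hlen]
  simp only [← hl]
  refine foldlM_readOnly 2 (fun pre r => (r = none → ∀ v ∈ pre, ¬ N.IsActive σ.flow v) ∧
      ∀ m, r = some m → (∃ v ∈ pre, N.IsActive σ.flow v ∧ σ.label v = m) ∧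
        ∀ v ∈ pre, N.IsActive σ.flow v → σ.label v ≤ m) ?_ (by simp) h
  clear h
  rintro pre x r _ σ₁ _ ⟨hQ1, hQ2⟩ ⟨b, _, _, _, h, ⟨_, _, _, _, ⟨rfl, rfl, rfl⟩,
    ⟨rfl, rfl, rfl⟩, rfl⟩, rfl⟩
  obtain ⟨hb, rfl, rfl⟩ := testActive_spec N h
  refine ⟨?_, rfl, rfl⟩
  by_cases hx : b = true
  · rw [if_pos hx]
    rw [hb] at hx
    refine ⟨by simp, fun m hm => ?_⟩
    rw [Option.some_inj] at hm
    cases r with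
    | none =>
      simp only [Option.getD_none] at hm
      have hQ := hQ1 rfl
      refine ⟨⟨x, by simp, hx, by omega⟩, fun v hv hva => ?_⟩
      rcases List.mem_append.1 hv with hv | hv
      · exact absurd hva (hQ v hv)
      · rw [List.mem_singleton.1 hv]; omega
    | some n =>
      simp only [Option.getD_some] at hm
      obtain ⟨⟨w, hw, hwa, hwl⟩, hQ⟩ := hQ2 n rfl
      constructor
      · rcases le_total n (σ₁.label x) with hle | hle
        · exact ⟨x, by simp, hx, by omega⟩
        · exact ⟨w, by simp [hw], hwa, by omega⟩
      · intro v hv hva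
        rcases List.mem_append.1 hv with hv | hv
        · have := hQ v hv hva; omega
        · rw [List.mem_singleton.1 hv]; omega
  · rw [if_neg hx]
    rw [hb] at hx
    constructor
    · intro hr v hv
      rcases List.mem_append.1 hv with hv | hv
      · exact hQ1 hr v hv
      · rwa [List.mem_singleton.1 hv]
    · intro m hm
      obtain ⟨⟨w, hw, hwa⟩, hQ⟩ := hQ2 m hm
      refine ⟨⟨w, by simp [hw], hwa⟩, fun v hv hva => ?_⟩
      rcases List.mem_append.1 hv with hv | hv
      · exact hQ v hv hva
      · rw [List.mem_singleton.1 hv] at hva; exact absurd hva hx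

theorem activeWithLabel_spec {m : ℕ} {σ σ' : PRState V} {U : Finset V} {tr : List (Event V)}
    (h : activeWithLabel N X m σ U σ' tr) :
    (∀ v, v ∈ U ↔ v ∈ X ∧ N.IsActive σ.flow v ∧ σ.label v = m) ∧
    σ' = σ ∧ tr = List.replicate (2 * X.card) Event.access := by
  obtain ⟨l, hnd, hl, hlen, h⟩ := exists_list_of_enum_bind h
  rw [← hlen]
  simp only [← hl]
  refine foldlM_readOnly 2 (fun pre U => ∀ v, v ∈ U ↔ v ∈ pre ∧ N.IsActive σ.flow v ∧
    σ.label v = m) ?_ (by simp) h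
  clear h
  rintro pre x S _ _ _ hQ ⟨b, _, _, _, h, ⟨_, _, _, _, ⟨rfl, rfl, rfl⟩,
    ⟨rfl, rfl, rfl⟩, rfl⟩, rfl⟩
  obtain ⟨hb, rfl, rfl⟩ := testActive_spec N h
  refine ⟨fun v => ?_, rfl, rfl⟩
  by_cases hvx : v = x <;> split_ifs with hx <;> rw [hb] at hx <;> simp [hQ, hvx, hx]

end

end Prog

end Programs

/-! ### The operations of the algorithm -/

section Operations

theorem Network.src_mem_apices {V : Type} [DecidableEq V] (N : Network V) (A : Finset V) :
    N.src ∈ N.apices A := by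
  simp [Network.apices]

theorem Network.snk_mem_apices {V : Type} [DecidableEq V] (N : Network V) (A : Finset V) :
    N.snk ∈ N.apices A := by
  simp [Network.apices]

variable {V : Type} [Fintype V] [DecidableEq V] {N : Network V} {X : Finset V}

theorem Network.IsActive.mem {σ : PRState V} (h : Invariants N X σ) {v : V}
    (hv : N.IsActive σ.flow v) : v ∈ X := by
  by_contra hX
  exact hv.2.2.ne' (h.excess_outside v hX)

/-- Raising the label of an active vertex to one more than a lower bound on the labels at the ends
of its residual arcs preserves the invariants. -/
theorem Invariants.update_label {σ : PRState V} (h : Invariants N X σ) (hsX : N.src ∈ X)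
    (htX : N.snk ∈ X) {u : V} (hu : N.IsActive σ.flow u) {n : ℕ} (hn : σ.label u ≤ n)
    (hle : ∀ v ∈ X, N.ArcResidual X σ.flow u v → n ≤ σ.label v) :
    Invariants N X ⟨σ.flow, Function.update σ.label u (n + 1)⟩ := by
  have hs : Function.update σ.label u (n + 1) N.src = X.card := by
    rw [Function.update_of_ne hu.1.symm, h.label_src]
  have ht : Function.update σ.label u (n + 1) N.snk = 0 := by
    rw [Function.update_of_ne hu.2.1.symm, h.label_snk]
  have hvalid : N.Valid X σ.flow (Function.update σ.label u (n + 1)) := by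
    intro x hx y hy hr
    by_cases hxu : x = u
    · subst hxu
      have := hle y hy hr
      rw [Function.update_self, Function.update_of_ne hr.1.symm]
      omega
    · have := h.label_valid x hx y hy hr
      rw [Function.update_of_ne hxu]
      by_cases hyu : y = u
      · subst hyu
        rw [Function.update_self]
        omega
      · rwa [Function.update_of_ne hyu]
  refine ⟨h.preflow, h.resCap_nonneg, h.excess_outside, hs, ht, hvalid, fun v hv => ?_⟩
  by_cases hvu : v = u
  · subst hvu
    exact hvalid.label_le_of_isActive h.preflow hsX htX hs ht hv hu
  · exact (Function.update_of_ne hvu (n + 1) σ.label).le.trans (h.label_le v hv)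

/-- A function grows at no point by more than its sum does. -/
theorem add_sum_le_add_sum {α : Type} [DecidableEq α] {f g : α → ℕ} (hfg : ∀ v, f v ≤ g v)
    {S : Finset α} {v : α} (hv : v ∈ S) : g v + ∑ x ∈ S, f x ≤ f v + ∑ x ∈ S, g x := by
  rw [← Finset.add_sum_erase S f hv, ← Finset.add_sum_erase S g hv]
  have := Finset.sum_le_sum fun x (_ : x ∈ S.erase v) => hfg x
  omega

namespace Prog

/-- Relabel, applied to an active vertex none of whose residual arcs leads downwards. -/
theorem relabel_spec {σ σ' : PRState V} {u : V} {tr : List (Event V)} (h : Invariants N X σ)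
    (hsX : N.src ∈ X) (htX : N.snk ∈ X) (hu : N.IsActive σ.flow u)
    (hle : ∀ v ∈ X, N.ArcResidual X σ.flow u v → σ.label u ≤ σ.label v)
    (hr : relabel N X u σ () σ' tr) :
    ∃ n, σ.label u < n ∧ σ' = ⟨σ.flow, Function.update σ.label u n⟩ ∧ Invariants N X σ' ∧
      (∀ e ∈ tr, e.Correct N X) ∧ TraceCounts tr X.card X.card 0 1 := by
  have huX : u ∈ X := hu.mem h
  obtain ⟨l, -, hl, hlen, r, σ₁, t₁, t₂, h1, h2, rfl⟩ := exists_list_of_enum_bind hr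
  obtain ⟨hnone, hsome, rfl, hcount, hcor⟩ := relabel_loop_spec N X h1
  have hl' : ∀ v ∈ X, N.ArcResidual X σ₁.flow u v → v ∈ l := fun v hv hr =>
    (hl v).2 (Finset.mem_erase.2 ⟨hr.1.symm, hv⟩)
  have hlX : ∀ v ∈ l, v ∈ X := fun v hv => Finset.mem_of_mem_erase ((hl v).1 hv)
  have hlc : l.length ≤ X.card := by rw [hlen]; exact Finset.card_erase_le
  cases r with
  | none =>
    -- An active vertex has a residual arc, so the loop does find a minimum.
    obtain ⟨v, hv, hr⟩ := Network.exists_arcResidual_of_isActive h.preflow hsX huX hu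
    exact absurd hr (hnone rfl v (hl' v hv hr))
  | some n =>
    obtain ⟨⟨w, hw, hwr, hwn⟩, hmin⟩ := hsome n rfl
    have hmin' : ∀ v ∈ X, N.ArcResidual X σ₁.flow u v → n ≤ σ₁.label v := fun v hv hr =>
      hmin v (hl' v hv hr) hr
    have hn : σ₁.label u ≤ n := hwn ▸ hle w (hlX w hw) hwr
    obtain ⟨rfl, rfl⟩ : σ' = ⟨σ₁.flow, Function.update σ₁.label u (n + 1)⟩ ∧
      t₂ = [Event.relabel u σ₁ σ'] := h2
    have hinv := h.update_label hsX htX hu hn hmin'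
    refine ⟨n + 1, by omega, rfl, hinv, ?_, ?_⟩
    · intro e he
      rcases List.mem_append.1 he with he | he
      · exact hcor e he
      · rw [List.mem_singleton.1 he]
        refine ⟨hu, hle, ⟨⟨w, hlX w hw, hwr, ?_⟩, ?_⟩, hinv, fun v _ => ?_, ?_⟩
        · simp [hwn]
        · rintro _ ⟨v, hv, hr, rfl⟩
          simpa using hmin' v hv hr
        · by_cases hvu : v = u
          · subst hvu; simp; omega
          · simp [Function.update_of_ne hvu]
        · simp; omega
    · exact (hcount.append (a' := 0) (b' := 0) (c' := 0) (d' := 1) (by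
        constructor <;> simp [List.countP_cons, Event.isAccess, Event.isArcTest,
          Event.isBulkPush, Event.isRelabel])).mono hlc hlc le_rfl

/-- The relabelling phase of an iteration. The counter `r` is the number of calls of Relabel;
each of them raises the sum of the labels. -/
theorem relabel_phase_spec {σ₁ σ' : PRState V} {U : Finset V} {m : ℕ} {l : List V}
    {tr : List (Event V)} (h : Invariants N X σ₁) (hsX : N.src ∈ X) (htX : N.snk ∈ X)
    (hnd : l.Nodup) (hl : ∀ x, x ∈ l ↔ x ∈ U) (hm : ∀ u ∈ U, σ₁.label u = m)
    (hle : ∀ u ∈ U, N.IsActive σ₁.flow u → ∀ v ∈ X, N.ArcResidual X σ₁.flow u v →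
      m ≤ σ₁.label v)
    (hr : (l.forM (fun u => do
      let b ← testActive N u
      if b then relabel N X u else pure ()) : Prog V Unit) σ₁ () σ' tr) :
    σ'.flow = σ₁.flow ∧ Invariants N X σ' ∧ (∀ e ∈ tr, e.Correct N X) ∧
    (∀ v, v ∉ U → σ'.label v = σ₁.label v) ∧ (∀ v, σ₁.label v ≤ σ'.label v) ∧
    ∃ r, TraceCounts tr (l.length + X.card * r) (X.card * r) 0 r ∧
      ∑ v ∈ X, σ₁.label v + r ≤ ∑ v ∈ X, σ'.label v ∧
      ∀ u ∈ U, N.IsActive σ₁.flow u → 1 ≤ r := by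
  simp only [← hl] at hm hle ⊢
  refine forM_invariant (fun pre σ tr => σ.flow = σ₁.flow ∧ Invariants N X σ ∧
    (∀ e ∈ tr, e.Correct N X) ∧ (∀ v, v ∉ pre → σ.label v = σ₁.label v) ∧
    (∀ v, σ₁.label v ≤ σ.label v) ∧
    ∃ r, TraceCounts tr (pre.length + X.card * r) (X.card * r) 0 r ∧
      ∑ v ∈ X, σ₁.label v + r ≤ ∑ v ∈ X, σ.label v ∧
      ∀ u ∈ pre, N.IsActive σ₁.flow u → 1 ≤ r) ?_ ?_ hr
  · rintro pre u post hpre ⟨ρ, lab⟩ tr σ' tr'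
      ⟨hflow, hinv, hcor, hout, hmono, r, hcount, hsum, hact⟩ ⟨b, σ₂, t₁, t₂, h1, h2, rfl⟩
    obtain ⟨hb, rfl, rfl⟩ := testActive_spec N h1
    dsimp only at hflow
    subst hflow
    have hul : u ∈ l := by simp [hpre]
    have hupre : u ∉ pre := by
      rw [hpre] at hnd
      exact fun hu => (List.nodup_append.1 hnd).2.2 u hu u (by simp) rfl
    have hone : TraceCounts [(Event.access : Event V)] 1 0 0 0 := .replicate_access 1
    by_cases hba : b = true
    · rw [if_pos hba] at h2
      rw [hb] at hba
      have hum : lab u = m := by rw [← hm u hul]; exact hout u hupre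
      obtain ⟨n, hn, rfl, hinv', hcor', hcount'⟩ := relabel_spec hinv hsX htX hba
        (fun v hv hr => by
          have h1 := hle u hul hba v hv hr
          have h2 := hmono v
          dsimp only at h2 ⊢
          omega) h2
      dsimp only at hn hout hmono hsum
      have hsum' : ∑ v ∈ X, Function.update lab u n v = n + ∑ v ∈ X.erase u, lab v := by
        rw [← Finset.add_sum_erase X _ (hba.mem hinv), Function.update_self]
        congr 1
        exact Finset.sum_congr rfl fun v hv => Function.update_of_ne (Finset.ne_of_mem_erase hv) _ _
      have hsum'' := Finset.add_sum_erase X lab (hba.mem hinv)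
      refine ⟨rfl, hinv', ?_, ?_, ?_, r + 1, ?_, ?_, fun _ _ _ => by omega⟩
      · intro e he
        simp only [List.mem_append, List.mem_singleton] at he
        rcases he with he | rfl | he
        · exact hcor e he
        · trivial
        · exact hcor' e he
      · intro v hv
        rw [List.mem_append, List.mem_singleton, not_or] at hv
        exact (Function.update_of_ne hv.2 _ _).trans (hout v hv.1)
      · intro v
        by_cases hvu : v = u
        · subst hvu
          have := hmono v
          simp only [Function.update_self]
          omega
        · simp only [Function.update_of_ne hvu]
          exact hmono v
      · refine (hcount.append (hone.append hcount')).mono ?_ ?_ le_rfl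
        · simp only [List.length_append, List.length_singleton, mul_add]; omega
        · simp only [mul_add]; omega
      · dsimp only
        omega
    · rw [if_neg hba] at h2
      rw [hb] at hba
      obtain ⟨-, rfl, rfl⟩ := h2
      refine ⟨rfl, hinv, ?_, ?_, hmono, r, ?_, hsum, ?_⟩
      · intro e he
        simp only [List.append_nil, List.mem_append, List.mem_singleton] at he
        rcases he with he | rfl
        · exact hcor e he
        · trivial
      · exact fun v hv => hout v fun hv' => hv (by simp [hv'])
      · refine (hcount.append hone).mono ?_ le_rfl le_rfl
        simp only [List.length_append, List.length_singleton]; omega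
      · intro v hv hva
        rcases List.mem_append.1 hv with hv | hv
        · exact hact v hv hva
        · rw [List.mem_singleton.1 hv] at hva; exact absurd hva hba
  · exact ⟨rfl, h, by simp, by simp, by simp, 0,
      TraceCounts.nil.mono (by omega) (by omega) le_rfl, by simp, by simp⟩

/-- A Bulk-Push from all active vertices of the highest label `m` to the label `m - 1`: it
preserves the invariants, and the arcs from sources that stay active to sinks are saturated. -/
theorem bulkPush_spec {σ σ' : PRState V} {U W : Finset V} {m : ℕ} {tr : List (Event V)}
    (h : Invariants N X σ) (hU : ∀ v, v ∈ U ↔ v ∈ X ∧ N.IsActive σ.flow v ∧ σ.label v = m)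
    (hW : ∀ v, v ∈ W ↔ v ∈ X ∧ σ.label v + 1 = m)
    (hmax : ∀ v ∈ X, N.IsActive σ.flow v → σ.label v ≤ m)
    (hp : bulkPush N X U W (fun σ u => (excess σ.flow u : WithTop ℝ)) σ () σ' tr) :
    Invariants N X σ' ∧ σ'.label = σ.label ∧ (∀ e ∈ tr, e.Correct N X) ∧
    TraceCounts tr 0 0 1 0 ∧
    (∀ u ∈ U, N.IsActive σ'.flow u → ∀ v ∈ X, N.ArcResidual X σ'.flow u v → m ≤ σ.label v) ∧
    ∀ v ∈ X, v ∉ U → N.IsActive σ'.flow v → σ.label v + 1 ≤ m := by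
  obtain ⟨η, c, hη, rfl, rfl⟩ := hp
  have hUX : U ⊆ X := fun v hv => ((hU v).1 hv).1
  have hWX : W ⊆ X := fun v hv => ((hW v).1 hv).1
  have hUW : Disjoint U W := Finset.disjoint_left.2 fun v hv hw => by
    have h1 := ((hU v).1 hv).2.2
    have h2 := ((hW v).1 hw).2
    omega
  have hpre := hη.1.isPreflow_addFlow h.preflow fun _ _ _ => le_rfl
  have hvalid : N.Valid X (addFlow σ.flow η) σ.label :=
    hη.1.valid_addFlow h.label_valid hUX hWX (fun u hu => ((hU u).1 hu).2.2)
      fun w hw => ((hW w).1 hw).2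
  have hinv : Invariants N X ⟨addFlow σ.flow η, σ.label⟩ :=
    { preflow := hpre
      resCap_nonneg := hpre.resCap_nonneg
      excess_outside := fun v hv => by
        rw [excess_addFlow, h.excess_outside v hv,
          hη.1.conserved v fun hv' => hv (Finset.union_subset hUX hWX hv'), zero_add]
      label_src := h.label_src
      label_snk := h.label_snk
      label_valid := hvalid
      label_le := h.label_le }
  have hsat : ∀ u ∈ U, ∀ w ∈ W, N.IsActive (addFlow σ.flow η) u →
      ¬ N.ArcResidual X (addFlow σ.flow η) u w := fun u hu w hw hact => by
    refine hη.not_arcResidual hUX hWX hUW hu hw hact.2.2 (WithTop.coe_le_coe.2 ?_)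
    rw [excess_addFlow, hη.1.excess_source hu]
    linarith
  refine ⟨hinv, rfl, ?_, ?_, fun u hu hact v hv hr => ?_, fun v hv hvU hact => ?_⟩
  · intro e he
    rw [List.mem_singleton.1 he]
    refine ⟨hinv, fun _ _ => le_rfl, fun u hu w hw => ?_⟩
    by_contra! hc
    exact hsat u hu w hw hc.2 hc.1
  · constructor <;> simp [List.countP_cons, Event.isAccess, Event.isArcTest,
      Event.isBulkPush, Event.isRelabel]
  · have h1 := hvalid u (hUX hu) v hv hr
    have h2 := ((hU u).1 hu).2.2
    by_contra hlt
    exact hsat u hu v ((hW v).2 ⟨hv, by omega⟩) hact hr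
  · by_cases hvW : v ∈ W
    · exact ((hW v).1 hvW).2.le
    · have hact' : N.IsActive σ.flow v := by
        refine ⟨hact.1, hact.2.1, ?_⟩
        have := hact.2.2
        rwa [excess_addFlow, hη.1.conserved v (by simp [hvU, hvW]), add_zero] at this
      have h1 := hmax v hv hact'
      have h2 : σ.label v ≠ m := fun e => hvU ((hU v).2 ⟨hv, hact', e⟩)
      omega

/-- The effect of an iteration of the main loop. If it does not terminate the algorithm, an active
vertex after it has either a label less than the previous maximum `m`, or a label that exceeds `m`
by at most the growth of the sum of the labels, in which case some vertex has been relabelled. -/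
theorem iteration_spec {σ σ' : PRState V} {b : Bool} {tr : List (Event V)}
    (h : Invariants N X σ) (hsX : N.src ∈ X) (htX : N.snk ∈ X)
    (hi : iteration N X σ b σ' tr) :
    Invariants N X σ' ∧ (∀ e ∈ tr, e.Correct N X) ∧
    ∃ r, TraceCounts tr (6 * X.card + X.card * r) (X.card * r) 1 r ∧
      ∑ v ∈ X, σ.label v + r ≤ ∑ v ∈ X, σ'.label v ∧
      (b = false → ∀ v, ¬ N.IsActive σ'.flow v) ∧
      (b = true → ∃ m, (∃ v ∈ X, N.IsActive σ.flow v ∧ σ.label v = m) ∧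
        ∀ v ∈ X, N.IsActive σ'.flow v → σ'.label v + 1 ≤ m ∨
          (1 ≤ r ∧ σ'.label v + ∑ v ∈ X, σ.label v ≤ m + ∑ v ∈ X, σ'.label v)) := by
  obtain ⟨o, σ₁, t₁, t₂, h1, h2, rfl⟩ := hi
  obtain ⟨⟨hnone, hsome⟩, rfl, rfl⟩ := maxActiveLabel_spec N X h1
  cases o with
  | none =>
    obtain ⟨rfl, rfl, rfl⟩ := h2
    rw [List.append_nil]
    refine ⟨h, Event.correct_of_mem_replicate_access, 0,
      (TraceCounts.replicate_access _).mono (by omega) (by omega) (by omega), by simp,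
      fun _ v hv => hnone rfl v (hv.mem h) hv, by simp⟩
  | some m =>
    obtain ⟨U, _, _, _, hUp, ⟨W, _, _, _, hWp, ⟨_, σ₂, t₃, _, hp, h2, rfl⟩, rfl⟩, rfl⟩ := h2
    obtain ⟨hU, rfl, rfl⟩ := activeWithLabel_spec N X hUp
    obtain ⟨hW, rfl, rfl⟩ := oneBelow_spec X hWp
    obtain ⟨l, hnd, hl, hlen, _, σ₃, t₄, _, hr, ⟨rfl, rfl, rfl⟩, rfl⟩ :=
      exists_list_of_enum_bind h2
    obtain ⟨hex, hmax⟩ := hsome m rfl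
    obtain ⟨hinv, hlab, hcor, hcount, hsat, hact⟩ := bulkPush_spec h hU hW hmax hp
    obtain ⟨hflow, hinv', hcor', hout, hmono, r, hcount', hsum, hrel⟩ :=
      relabel_phase_spec (m := m) hinv hsX htX hnd hl
        (fun u hu => by rw [hlab]; exact ((hU u).1 hu).2.2) (by rw [hlab]; exact hsat) hr
    rw [hlab] at hout hmono hsum
    refine ⟨hinv', ?_, r, ?_, hsum, by simp, fun _ => ⟨m, hex, fun v hv hva => ?_⟩⟩
    · intro e he
      simp only [List.mem_append, List.append_nil] at he
      rcases he with he | he | he | he | he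
      · exact Event.correct_of_mem_replicate_access e he
      · exact Event.correct_of_mem_replicate_access e he
      · exact Event.correct_of_mem_replicate_access e he
      · exact hcor e he
      · exact hcor' e he
    · have hc : l.length ≤ X.card :=
        hlen ▸ Finset.card_le_card fun v hv => ((hU v).1 hv).1
      have hc' := (TraceCounts.replicate_access (V := V) (2 * X.card)).append
        ((TraceCounts.replicate_access (2 * X.card)).append
          ((TraceCounts.replicate_access X.card).append
            (hcount.append (hcount'.append .nil))))
      simp only [zero_add, add_zero] at hc'
      exact hc'.mono (by omega) le_rfl le_rfl
    · rw [hflow] at hva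
      by_cases hvU : v ∈ U
      · refine .inr ⟨hrel v hvU hva, ?_⟩
        have hvm := ((hU v).1 hvU).2.2
        have hgrow := add_sum_le_add_sum hmono hv
        omega
      · left
        rw [hout v hvU]
        exact hact v hv hvU hva

end Prog

end Operations

/-! ### Executions -/

section Executions

theorem Network.card_apices_le {V : Type} [DecidableEq V] (N : Network V) (A : Finset V) :
    (N.apices A).card ≤ A.card + 2 :=
  (Finset.card_insert_le _ _).trans (Nat.add_le_add_right (Finset.card_insert_le _ _) 1)

theorem Invariants.sum_label_le {V : Type} [Fintype V] {N : Network V} {X : Finset V}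
    {σ : PRState V} (h : Invariants N X σ) :
    ∑ v ∈ X, σ.label v ≤ 2 * X.card ^ 2 := by
  have h1 := Finset.sum_le_card_nsmul X σ.label (2 * X.card)
    fun v hv => (h.label_le v hv).trans (Nat.sub_le _ _)
  rw [smul_eq_mul] at h1
  nlinarith

theorem Prog.writeLabels_spec {V : Type} [DecidableEq V] {σ σ' : PRState V} {f : V → ℕ}
    {l : List V} {tr : List (Event V)}
    (h : (l.forM (fun v => Prog.writeLabel v (f v)) : Prog V Unit) σ () σ' tr) :
    σ'.flow = σ.flow ∧ (∀ v ∈ l, σ'.label v = f v) ∧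
      tr = List.replicate l.length Event.access := by
  refine Prog.forM_invariant (fun pre σ' tr => σ'.flow = σ.flow ∧ (∀ v ∈ pre, σ'.label v = f v) ∧
    tr = List.replicate pre.length Event.access) ?_ ⟨rfl, by simp, rfl⟩ h
  rintro pre x post - σ₁ tr _ _ ⟨hflow, hlab, rfl⟩ ⟨rfl, rfl⟩
  refine ⟨hflow, fun v hv => ?_, ?_⟩
  · by_cases hvx : v = x
    · subst hvx; simp
    · rw [List.mem_append, List.mem_singleton, or_iff_left hvx] at hv
      simpa [Function.update_of_ne hvx] using hlab v hv
  · rw [List.length_append, List.length_singleton, List.replicate_add]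
    rfl

variable {V : Type} [Fintype V] [DecidableEq V] {N : Network V} {X : Finset V}

namespace Prog

/-- After the initialization the source has label `|X|` and no residual arc of the complete graph
leaves it, so the labels are valid. -/
theorem setup_spec {lab : V → ℕ} {σ : PRState V} {tr : List (Event V)} (hsX : N.src ∈ X)
    (htX : N.snk ∈ X) (h : setup N X ⟨fun _ _ => 0, lab⟩ () σ tr) :
    Invariants N X σ ∧ (∀ e ∈ tr, e.Correct N X) ∧ TraceCounts tr X.card 0 1 0 ∧
    (∃ e ∈ tr, e.isBulkPush = true ∧ X.card ≤ e.time) ∧ ∑ v ∈ X, σ.label v = X.card ∧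
    ∀ v ∈ X, v ≠ N.src → σ.label v = 0 := by
  obtain ⟨l, -, hl, hlen, _, ⟨ρ, lab₁⟩, t₁, _, h1, ⟨η, c, hη, rfl, rfl⟩, rfl⟩ :=
    exists_list_of_enum_bind h
  obtain ⟨hflow, hlab, rfl⟩ := writeLabels_spec h1
  dsimp only at hflow hlab hη ⊢
  subst hflow
  have hs : lab₁ N.src = X.card := by simpa using hlab _ ((hl _).2 hsX)
  have h0 : ∀ v ∈ X, v ≠ N.src → lab₁ v = 0 := fun v hv hvs => by
    simpa [hvs] using hlab v ((hl v).2 hv)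
  have hz : N.IsPreflow fun _ _ => 0 :=
    ⟨fun _ _ => le_rfl, N.cap_nonneg, fun _ _ => by simp [excess]⟩
  have hUX : {N.src} ⊆ X := Finset.singleton_subset_iff.2 hsX
  have hWX : X.erase N.src ⊆ X := Finset.erase_subset _ _
  have hpre := hη.1.isPreflow_addFlow hz fun u hu hus => absurd (Finset.mem_singleton.1 hu) hus
  have hcard := Finset.card_pos.2 ⟨_, hsX⟩
  have hinv : Invariants N X ⟨addFlow (fun _ _ => 0) η, lab₁⟩ :=
    { preflow := hpre
      resCap_nonneg := hpre.resCap_nonneg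
      excess_outside := fun v hv => by
        rw [excess_addFlow, hη.1.conserved v fun hv' => hv (Finset.union_subset hUX hWX hv')]
        simp [excess]
      label_src := hs
      label_snk := h0 _ htX N.src_ne_snk.symm
      label_valid := fun u hu v hv hr => by
        by_cases hus : u = N.src
        · subst hus
          -- The source may send an unlimited amount, so any surplus is available to it.
          exact absurd hr (hη.not_arcResidual hUX hWX
            (Finset.disjoint_singleton_left.2 (Finset.notMem_erase _ _))
            (Finset.mem_singleton_self _) (Finset.mem_erase.2 ⟨hr.1.symm, hv⟩) one_pos le_top)
        · exact (h0 u hu hus).le.trans (Nat.zero_le _)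
      label_le := fun v hv => by
        dsimp only
        by_cases hvs : v = N.src
        · rw [hvs, hs]; omega
        · rw [h0 v hv hvs]; omega }
  refine ⟨hinv, ?_, ?_, ?_, ?_, h0⟩
  · intro e he
    rcases List.mem_append.1 he with he | he
    · exact Event.correct_of_mem_replicate_access e he
    · rw [List.mem_singleton.1 he]
      refine ⟨hinv, fun _ _ => le_rfl, fun u hu _ _ => .inr fun hact => ?_⟩
      exact hact.1 (Finset.mem_singleton.1 hu)
  · rw [hlen]
    exact ((TraceCounts.replicate_access _).append (a' := 0) (b' := 0) (c' := 1) (d' := 0) (by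
        constructor <;> simp [List.countP_cons, Event.isAccess, Event.isArcTest,
          Event.isBulkPush, Event.isRelabel])).mono le_rfl le_rfl le_rfl
  · exact ⟨_, List.mem_append_right _ (List.mem_singleton_self _), rfl, Nat.le_add_right _ _⟩
  · rw [← Finset.add_sum_erase X _ hsX, hs, Finset.sum_eq_zero fun v hv =>
      h0 v (Finset.mem_of_mem_erase hv) (Finset.ne_of_mem_erase hv), add_zero]

theorem exists_setup (σ : PRState V) (hσ : N.IsPreflow σ.flow) :
    ∃ σ' tr, setup N X σ () σ' tr := by
  obtain ⟨l, σ₁, t₁, h1⟩ := total_enum X σ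
  obtain ⟨rfl, -⟩ : σ₁ = σ ∧ t₁ = [] := h1.2.2
  obtain ⟨_, σ₂, t₂, h2⟩ := Total.forM
    (fun v => total_writeLabel v (if v = N.src then X.card else 0)) l σ₁
  obtain ⟨η, hη⟩ := Network.exists_isMaxBoundedFlow (N := N) (X := X) (U := {N.src})
    (W := X.erase N.src) (lim := fun _ => ⊤) (ρ := σ₂.flow)
    (by rw [(writeLabels_spec h2).1]; exact hσ.resCap_nonneg) (by simp)
  exact ⟨_, _, l, _, _, _, h1, ⟨_, _, _, _, h2, ⟨η, 0, hη, rfl, rfl⟩, rfl⟩, rfl⟩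

theorem exists_iteration {σ : PRState V} (h : Invariants N X σ) :
    ∃ b σ' tr, iteration N X σ b σ' tr := by
  obtain ⟨o, σ₁, t₁, h1⟩ := total_maxActiveLabel N X σ
  obtain ⟨-, rfl, -⟩ := maxActiveLabel_spec N X h1
  cases o with
  | none => exact ⟨false, _, _, none, _, _, _, h1, ⟨rfl, rfl, rfl⟩, rfl⟩
  | some m =>
    obtain ⟨U, σ₂, t₂, h2⟩ := total_activeWithLabel N X m σ₁
    obtain ⟨hU, rfl, -⟩ := activeWithLabel_spec N X h2
    obtain ⟨W, σ₃, t₃, h3⟩ := total_oneBelow X m σ₂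
    obtain ⟨-, rfl, -⟩ := oneBelow_spec X h3
    obtain ⟨η, hη⟩ := Network.exists_isMaxBoundedFlow (N := N) (X := X) (U := U) (W := W)
      (lim := fun u => (excess σ₃.flow u : WithTop ℝ)) h.resCap_nonneg
      fun u hu => WithTop.coe_le_coe.2 ((hU u).1 hu).2.1.2.2.le
    have htot : Total (do
        let l ← enum U
        l.forM (fun u => do
          let b ← testActive N u
          if b then relabel N X u else pure ())
        pure true) := by
      refine (total_enum U).bind fun l => (Total.forM (fun u => (total_testActive N u).bind
        fun b => ?_) l).bind fun _ => .pure true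
      cases b
      · exact .pure ()
      · exact total_relabel N X u
    obtain ⟨b, σ₅, t₅, h5⟩ := htot ⟨addFlow σ₃.flow η, σ₃.label⟩
    exact ⟨b, σ₅, _, some m, _, _, _, h1, ⟨U, _, _, _, h2, ⟨W, _, _, _, h3,
      ⟨(), _, _, _, ⟨η, 0, hη, rfl, rfl⟩, h5, rfl⟩, rfl⟩, rfl⟩, rfl⟩

end Prog

/-- What holds after `n` iterations. With `L` the sum of the labels of the vertices of `X` and
`h` the largest label of an active vertex, the quantity `2 L - h` grows in every iteration: either
a vertex is relabelled, and `h` grows at most as much as `L`, or `L` is unchanged and `h`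
decreases. This is expressed by `iterations_le` and `active_le`; the last iteration, which only
finds that no vertex is active, is accounted for in `iterations_le_succ`. -/
structure ExecutionInvariant (N : Network V) (X : Finset V) (n : ℕ) (running : Bool)
    (σ : PRState V) (tr : List (Event V)) : Prop where
  invariants : Invariants N X σ
  correct : ∀ e ∈ tr, e.Correct N X
  exists_bulkPush : ∃ e ∈ tr, e.isBulkPush = true ∧ X.card ≤ e.time
  iterations_le : running = true → n ≤ 2 * ∑ v ∈ X, σ.label v
  iterations_le_succ : n ≤ 2 * ∑ v ∈ X, σ.label v + 1
  active_le : running = true → ∀ v ∈ X, N.IsActive σ.flow v →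
    σ.label v + 1 + n ≤ 2 * ∑ v ∈ X, σ.label v
  not_active : running = false → ∀ v, ¬ N.IsActive σ.flow v
  counts : ∃ r, TraceCounts tr (X.card + 6 * X.card * n + X.card * r) (X.card * r) (n + 1) r ∧
    r ≤ ∑ v ∈ X, σ.label v

theorem Execution.invariant {n : ℕ} {running : Bool} {σ : PRState V} {tr : List (Event V)}
    (hsX : N.src ∈ X) (htX : N.snk ∈ X) (h : Execution N X n running σ tr) :
    ExecutionInvariant N X n running σ tr := by
  induction h with
  | start h =>
    obtain ⟨hinv, hcor, hcount, hbp, hsum, hlab⟩ := Prog.setup_spec hsX htX h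
    have hpos := Finset.card_pos.2 ⟨_, hsX⟩
    exact
      { invariants := hinv
        correct := hcor
        exists_bulkPush := hbp
        iterations_le := by simp
        iterations_le_succ := by simp
        active_le := fun _ v hv hva => by rw [hlab v hv hva.1, hsum]; omega
        not_active := by simp
        counts := ⟨0, hcount.mono (by simp) (by simp) (by simp), by simp⟩ }
  | @step n b σ σ' tr tr' _ hi ih =>
    obtain ⟨hinv, hcor, r', hcount', hsum, hterm, hrun⟩ :=
      Prog.iteration_spec ih.invariants hsX htX hi
    have hn := ih.iterations_le rfl
    have hact := ih.active_le rfl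
    obtain ⟨r, hcount, hr⟩ := ih.counts
    exact
      { invariants := hinv
        correct := fun e he => (List.mem_append.1 he).elim (ih.correct e) (hcor e)
        exists_bulkPush := by
          obtain ⟨e, he, h⟩ := ih.exists_bulkPush
          exact ⟨e, List.mem_append_left _ he, h⟩
        iterations_le := fun hb => by
          obtain ⟨m, ⟨v, hv, hva, rfl⟩, -⟩ := hrun hb
          have := hact v hv hva
          omega
        iterations_le_succ := by omega
        active_le := fun hb w hw hwa => by
          obtain ⟨m, ⟨v, hv, hva, rfl⟩, h⟩ := hrun hb
          have h1 := hact v hv hva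
          rcases h w hw hwa with h2 | ⟨h2, h3⟩ <;> omega
        not_active := hterm
        counts := ⟨r + r', (hcount.append hcount').mono
          (by simp only [mul_add, mul_one]; omega) (by rw [mul_add]) (by omega), by omega⟩ }

theorem Invariants.isMaxFlow {σ : PRState V} (h : Invariants N X σ) (hsX : N.src ∈ X)
    (htX : N.snk ∈ X) (hact : ∀ v, ¬ N.IsActive σ.flow v) : N.IsMaxFlow σ.flow := by
  refine Network.Valid.isMaxFlow (h := σ.label) h.label_valid ⟨h.preflow, fun v hs ht => ?_⟩
    hsX htX h.label_src h.label_snk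
  exact le_antisymm (not_lt.1 fun hpos => hact v ⟨hs, ht, hpos⟩) (h.preflow.excess_nonneg v hs)

end Executions

theorem mainTheorem3 (a : ℕ) :
    ∃ C : ℕ, ∀ (V : Type) [Fintype V] [DecidableEq V] (N : Network V) (A : Finset V) (k : ℕ),
      A.card = k → 1 ≤ k →
      (∃ σ tr, Execution N (N.apices A) 0 true σ tr) ∧
      ∀ (n : ℕ) (running : Bool) (σ : PRState V) (tr : List (Event V)),
        Execution N (N.apices A) n running σ tr →
        -- invariants (1)-(4) and property (5*)
        (∀ e ∈ tr, e.Correct N (N.apices A)) ∧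
        -- number of iterations and of calls of Bulk-Push and Relabel
        n ≤ C * k ^ 2 ∧ tr.countP Event.isBulkPush ≤ C * k ^ 2 ∧
        tr.countP Event.isRelabel ≤ C * k ^ 2 ∧
        -- running time, where a Bulk-Push takes time at most `T` and a test whether an arc of
        -- `K^×` is residual at most `q`
        (∀ T q : ℕ, (∀ e ∈ tr, e.isBulkPush = true → e.time ≤ T) →
          (∀ e ∈ tr, e.isArcTest = true → e.time ≤ q) → k * q ≤ a * T →
          (tr.map Event.time).sum ≤ C * (k ^ 2 * T)) ∧
        -- the algorithm never gets stuck
        (running = true → ∃ b σ' tr', Prog.iteration N (N.apices A) σ b σ' tr') ∧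
        -- when it terminates, it has found a maximum flow
        (running = false → N.IsMaxFlow σ.flow) := by
  -- With `K = |X| ≤ 3 k`, there are at most `18 k ^ 2` relabels and `37 k ^ 2` iterations, each
  -- of which uses `6 K ≤ 6 T` accesses; each relabel makes at most `K` arc tests, which cost
  -- `K q ≤ 3 a T`. The sum of these contributions is `(297 + 54 a) k ^ 2 T`.
  refine ⟨300 + 54 * a, ?_⟩
  rintro V _ _ N A k rfl hk
  have hsX := N.src_mem_apices A
  have htX := N.snk_mem_apices A
  have hXle := N.card_apices_le A
  constructor
  · obtain ⟨σ, tr, h⟩ := Prog.exists_setup (N := N) (X := N.apices A) ⟨fun _ _ => 0, fun _ => 0⟩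
      ⟨fun _ _ => le_rfl, N.cap_nonneg, fun _ _ => by simp [excess]⟩
    exact ⟨σ, tr, .start h⟩
  intro n running σ tr hexec
  have h := hexec.invariant hsX htX
  have hsum := h.invariants.sum_label_le
  obtain ⟨r, hcount, hr⟩ := h.counts
  set k := A.card
  set K := (N.apices A).card
  have hK : K ≤ 3 * k := by omega
  have hK2 : K ^ 2 ≤ 9 * k ^ 2 := by
    calc K ^ 2 ≤ (3 * k) ^ 2 := Nat.pow_le_pow_left hK 2
      _ = 9 * k ^ 2 := by ring
  have hk2 : 1 ≤ k ^ 2 := Nat.one_le_pow _ _ hk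
  have hr' : r ≤ 18 * k ^ 2 := by omega
  have hn' : n ≤ 37 * k ^ 2 := by
    have := h.iterations_le_succ
    omega
  have hC : 300 * k ^ 2 ≤ (300 + 54 * a) * k ^ 2 := Nat.mul_le_mul_right _ (Nat.le_add_right _ _)
  refine ⟨h.correct, by omega, ?_, ?_, fun T q hT hq hkq => ?_, fun _ =>
    Prog.exists_iteration h.invariants, fun hrun =>
    h.invariants.isMaxFlow hsX htX (h.not_active hrun)⟩
  · have := hcount.bulkPush_le
    omega
  · rw [hcount.relabel_eq]
    omega
  · -- Going through the apices is part of the time of the Bulk-Push of the initialization.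
    have hKT : K ≤ T := by
      obtain ⟨e, he, hbp, hle⟩ := h.exists_bulkPush
      exact hle.trans (hT e he hbp)
    have hT1 : 1 ≤ T := (Finset.card_pos.2 ⟨_, hsX⟩).trans_le hKT
    have h1 : K * q ≤ 3 * (a * T) :=
      calc K * q ≤ 3 * k * q := Nat.mul_le_mul_right q hK
        _ = 3 * (k * q) := by ring
        _ ≤ 3 * (a * T) := Nat.mul_le_mul_left 3 hkq
    calc (tr.map Event.time).sum
        ≤ (K + 6 * K * n + K * r) + K * r * q + (n + 1) * T + r := hcount.sum_time_le hT hq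
      _ = K * 1 + 6 * (K * n) + K * r + (K * q) * r + n * T + 1 * T + r * 1 := by ring
      _ ≤ T * k ^ 2 + 6 * (T * (37 * k ^ 2)) + T * (18 * k ^ 2) + 3 * (a * T) * (18 * k ^ 2) +
          37 * k ^ 2 * T + k ^ 2 * T + 18 * k ^ 2 * T := by gcongr
      _ = (297 + 54 * a) * (k ^ 2 * T) := by ring
      _ ≤ (300 + 54 * a) * (k ^ 2 * T) := by gcongr; norm_num
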